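/- Let $R$ be a commutative artinian ring and let $\mathcal C$ be an $R$-variety, i.e. a small additive category in which idempotents split, whose morphism sets are $R$-modules and whose composition is $R$-bilinear. Let $\mathrm{Mod}(\mathcal C)$ be the category of $R$-linear functors $\mathcal C\to\mathrm{Mod}(R)$, and let $\mathrm{mod}(\mathcal C)$ be its full subcategory of finitely presented functors, i.e. of those $M$ for which there is an exact sequence $\mathrm{Hom}_{\mathcal C}(C_0,-)\to\mathrm{Hom}_{\mathcal C}(C_1,-)\to M\to 0$. Let $E$ be the injective envelope of the $R$-module $R/\mathrm{rad}(R)$. Assume that $\mathcal C$ is dualizing: every $\mathrm{Hom}_{\mathcal C}(C_1,C_2)$ is a finitely generated $R$-module, and $M\mapsto \mathrm{Hom}_R(M(-),E)$ induces a duality between $\mathrm{mod}(\mathcal C)$ and $\mathrm{mod}(\mathcal C^{op})$. Let $C\in\mathcal C$, $P=\mathrm{Hom}_{\mathcal C}(C,-)\in\mathrm{mod}(\mathcal C)$ and $R_P=\mathrm{End}_{\mathrm{mod}(\mathcal C)}(P)^{op}$. Write $\mathrm{mod}(R_P)$ for the category of finitely generated left $R_P$-modules, and $\mathrm{proj}(R_P)$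 and $\mathrm{inj}(R_P)$ for its full subcategories of projective and of injective $R_P$-modules. Let $\mathrm{rad}(P)$ be the intersection of the maximal submodules of $P$. For $M\in\mathrm{mod}(\mathcal C)$ let $\mathrm{add}(M)$ be the full subcategory of those $X\in\mathrm{mod}(\mathcal C)$ with $X\oplus Y\simeq M^n$ for some $Y\in\mathrm{mod}(\mathcal C)$ and $n\in\mathbb N$. Then $\mathrm{Hom}_{\mathrm{mod}(\mathcal C)}(P,X)\in\mathrm{mod}(R_P)$ for all $X\in \mathrm{mod}(\mathcal C)$, and $P/\mathrm{rad}(P)$ belongs to $\mathrm{mod}(\mathcal C)$ and has an injective envelope in $\mathrm{mod}(\mathcal C)$. Let $J$ be such an injective envelope. For $k\ge 0$ let $\mathbb P_k$ be the full subcategory of $\mathrm{mod}(\mathcal C)$ of the modules $X$ having a projective resolution $\cdots\to P_1\to P_0\to X\to 0$ in $\mathrm{mod}(\mathcal C)$ with $P_i\in\mathrm{add}(P)$ for $0\le i\le k$, and let $\mathbb I_k$ be the full subcategory of the modules $Y$ having an injective coresolution $0\to Y\to J_0\to J_1\to\cdots$ in $\mathrm{mod}(\mathcal C)$ with $J_i\in\mathrm{add}(J)$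 for $0\le i\le k$. For $X,Y\in\mathrm{mod}(\mathcal C)$ let $$\rho_{X,Y}:\mathrm{Hom}_{\mathrm{mod}(\mathcal C)}(X,Y)\to\mathrm{Hom}_{R_P}\bigl(\mathrm{Hom}_{\mathrm{mod}(\mathcal C)}(P,X),\mathrm{Hom}_{\mathrm{mod}(\mathcal C)}(P,Y)\bigr),\qquad f\mapsto \mathrm{Hom}_{\mathrm{mod}(\mathcal C)}(P,f).$$ (a) The functor $\mathrm{Hom}_{\mathrm{mod}(\mathcal C)}(P,-)$ restricts to equivalences $\mathbb P_1\to\mathrm{mod}(R_P)$ and $\mathbb I_1\to\mathrm{mod}(R_P)$. (b) (i) $\rho_{X,Y}$ is a monomorphism if $X\in\mathbb P_0$ or $Y\in\mathbb I_0$; (ii) $\rho_{X,Y}$ is an isomorphism if $X\in\mathbb P_0$ and $Y\in\mathbb I_0$; (iii) $\rho_{X,Y}$ is an isomorphism if $X\in\mathbb P_1$ or $Y\in\mathbb I_1$. (c) The functor $\mathrm{Hom}_{\mathrm{mod}(\mathcal C)}(P,-)$ restricts to equivalences $\mathrm{add}(P)\to\mathrm{proj}(R_P)$ and $\mathrm{add}(J)\to\mathrm{inj}(R_P)$.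 -/

import Mathlib

open CategoryTheory CategoryTheory.Limits Opposite

universe u v w v' w'

noncomputable section

namespace DualizingVarieties

/-! ### General notions in (preadditive) categories -/

/-- The functor `F` restricts to an equivalence between the full subcategories of the objects
satisfying `S` and of the objects satisfying `T`. -/
def RestrictsToEquivalence {A : Type w} [Category.{v} A] {B : Type w'} [Category.{v'} B]
    (F : A ⥤ B) (S : ObjectProperty A) (T : ObjectProperty B) : Prop :=
  ∃ h : ∀ X : A, S X → T (F.obj X),
    (T.lift (S.ι ⋙ F) (fun X => h X.obj X.property)).IsEquivalence

/-- `i : M ⟶ J` is an injective envelope: an essential monomorphism into an injective object. -/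
structure IsInjectiveEnvelope {A : Type w} [Category.{v} A] {M J : A} (i : M ⟶ J) : Prop where
  mono : Mono i
  injective : Injective J
  essential : ∀ ⦃Z : A⦄ (g : J ⟶ Z), Mono (i ≫ g) → Mono g

/-- `add(M)`: the objects `X` such that `X ⊕ Y ≅ Mⁿ` for some object `Y` and some `n : ℕ`. -/
def add {A : Type w} [Category.{v} A] [Preadditive A] (M : A) : ObjectProperty A := fun X =>
  ∃ (Y : A) (n : ℕ) (b : BinaryBicone X Y) (c : Bicone (fun _ : Fin n => M)),
    Nonempty b.IsBilimit ∧ Nonempty c.IsBilimit ∧ Nonempty (b.pt ≅ c.pt)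

/-- The opposite of an `R`-linear category is `R`-linear. -/
instance linearOpposite (R : Type w') [Semiring R] (C : Type w) [Category.{v} C] [Preadditive C]
    [Linear R C] : Linear R Cᵒᵖ where
  homModule X Y :=
    { smul := fun r f => (r • f.unop).op
      one_smul := fun f => Quiver.Hom.unop_inj (one_smul R f.unop)
      mul_smul := fun r s f => Quiver.Hom.unop_inj (mul_smul r s f.unop)
      smul_zero := fun r => Quiver.Hom.unop_inj (smul_zero (A := unop Y ⟶ unop X) r)
      smul_add := fun r f g => Quiver.Hom.unop_inj (smul_add r f.unop g.unop)
      add_smul := fun r s f => Quiver.Hom.unop_inj (add_smul r s f.unop)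
      zero_smul := fun f => Quiver.Hom.unop_inj (zero_smul R f.unop) }
  smul_comp _ _ _ r f g := Quiver.Hom.unop_inj (Linear.comp_smul _ _ _ g.unop r f.unop)
  comp_smul _ _ _ f r g := Quiver.Hom.unop_inj (Linear.smul_comp _ _ _ r g.unop f.unop)

/-! ### Modules over an `R`-category -/

section Modules

variable (R : Type u) [CommRing R]
variable (C : Type u) [SmallCategory C] [Preadditive C] [Linear R C]

/-- The (covariant) `C`-modules among all functors `C ⥤ Mod R`: the `R`-linear functors. -/
def isModule : ObjectProperty (C ⥤ ModuleCat.{u} R) := fun F => F.Additive ∧ F.Linear R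

/-- The category `Mod(C)` of `C`-modules. -/
abbrev Mod := (isModule R C).FullSubcategory

variable {R C}

/-- The `R`-linear component at `X` of a morphism of `C`-modules. -/
def Mod.app {M N : Mod R C} (f : M ⟶ N) (X : C) : M.obj.obj X →ₗ[R] N.obj.obj X :=
  (f.hom.app X).hom

/-- Exactness of `L ⟶ M ⟶ N` at `M` in `Mod(C)`. -/
def Mod.Exact {L M N : Mod R C} (f : L ⟶ M) (g : M ⟶ N) : Prop :=
  ∀ X : C, Function.Exact (Mod.app f X) (Mod.app g X)

/-- Exactness of `M ⟶ N ⟶ 0` at `N` in `Mod(C)`. -/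
def Mod.IsEpi {M N : Mod R C} (f : M ⟶ N) : Prop :=
  ∀ X : C, Function.Surjective (Mod.app f X)

/-- Exactness of `0 ⟶ M ⟶ N` at `M` in `Mod(C)`. -/
def Mod.IsMono {M N : Mod R C} (f : M ⟶ N) : Prop :=
  ∀ X : C, Function.Injective (Mod.app f X)

variable (R) in
/-- The representable `C`-module `Hom_C(X, -)`. -/
def rep (X : C) : Mod R C :=
  ⟨(linearCoyoneda R C).obj (op X), inferInstance,
    { map_smul := fun f r => by
        ext (g : X ⟶ _)
        exact Linear.comp_smul _ _ _ g r f }⟩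

variable (R C) in
/-- `M` is finitely presented if there is an exact sequence
`Hom_C(X₀, -) ⟶ Hom_C(X₁, -) ⟶ M ⟶ 0`. -/
def isFinPres : ObjectProperty (Mod R C) := fun M =>
  ∃ (X₀ X₁ : C) (φ : rep R X₀ ⟶ rep R X₁) (π : rep R X₁ ⟶ M), Mod.Exact φ π ∧ Mod.IsEpi π

variable (R C) in
/-- The category `mod(C)` of finitely presented `C`-modules. -/
abbrev FPMod := (isFinPres R C).FullSubcategory

theorem isFinPres_rep (X : C) : isFinPres R C (rep R X) :=
  ⟨X, X, 0, 𝟙 _, fun _ _ => ⟨fun h => ⟨0, h.symm⟩, fun ⟨_, h⟩ => h.symm⟩, fun _ g => ⟨g, rfl⟩⟩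

variable (R) in
/-- The representable `Hom_C(X, -)` as an object of `mod(C)`. -/
def fpRep (X : C) : FPMod R C := ⟨rep R X, isFinPres_rep X⟩

/-! ### Radical and top of a module -/

/-- A submodule (additive, equivalently `R`-linear, subfunctor) of a `C`-module. -/
@[ext]
structure Sub (M : Mod R C) where
  /-- the value of the submodule at `X` -/
  carrier (X : C) : Submodule R (M.obj.obj X)
  map_mem {X Y : C} (f : X ⟶ Y) {x : M.obj.obj X} :
    x ∈ carrier X → (M.obj.map f).hom x ∈ carrier Y

instance (M : Mod R C) : PartialOrder (Sub M) :=
  PartialOrder.lift Sub.carrier (fun _ _ h => Sub.ext h)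

instance (M : Mod R C) : OrderTop (Sub M) where
  top := ⟨fun _ => ⊤, fun _ _ _ => Submodule.mem_top⟩
  le_top _ _ := le_top

/-- The quotient of a `C`-module by a submodule. -/
def Sub.quotient {M : Mod R C} (N : Sub M) : Mod R C :=
  ⟨{ obj := fun X => ModuleCat.of R (M.obj.obj X ⧸ N.carrier X)
     map := fun {X Y} f => ModuleCat.ofHom
       (Submodule.mapQ (N.carrier X) (N.carrier Y) (M.obj.map f).hom (fun _ hx => N.map_mem f hx))
     map_id := fun X => by
       ext x
       simp
     map_comp := fun f g => by
       ext x
       simp },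
   { map_add := fun {X Y f g} => by
       have := M.property.1
       ext x
       simp },
   { map_smul := fun {X Y} f r => by
       have := M.property.2
       ext x
       simp }⟩

/-- The radical of a `C`-module: the intersection of its maximal submodules. -/
def rad (M : Mod R C) : Sub M where
  carrier X := ⨅ N : {N : Sub M // IsCoatom N}, N.1.carrier X
  map_mem := by
    intro X Y f x hx
    exact (Submodule.mem_iInf _).2 fun N => N.1.map_mem f ((Submodule.mem_iInf _).1 hx N)

/-! ### The subcategories `ℙ_k` and `𝕀_k` of `mod(C)` -/

/-- `ℙ_k`: the modules `X` in `mod(C)` having a projective resolution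
`⋯ ⟶ P₁ ⟶ P₀ ⟶ X ⟶ 0` in `mod(C)` with `P_n ∈ add(P)` for `n ≤ k`. -/
def PP (P : FPMod R C) (k : ℕ∞) : ObjectProperty (FPMod R C) := fun X =>
  ∃ (Q : ℕ → FPMod R C) (d : ∀ n, Q (n + 1) ⟶ Q n) (ε : Q 0 ⟶ X),
    (∀ n, Projective (Q n)) ∧
    Mod.IsEpi ε.hom ∧ Mod.Exact (d 0).hom ε.hom ∧
    (∀ n, Mod.Exact (d (n + 1)).hom (d n).hom) ∧
    ∀ n : ℕ, (n : ℕ∞) ≤ k → add P (Q n)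

/-- `𝕀_k` (with respect to `J`): the modules `Y` in `mod(C)` having an injective coresolution
`0 ⟶ Y ⟶ J₀ ⟶ J₁ ⟶ ⋯` in `mod(C)` with `J_n ∈ add(J)` for `n ≤ k`. -/
def II (J : FPMod R C) (k : ℕ∞) : ObjectProperty (FPMod R C) := fun Y =>
  ∃ (I : ℕ → FPMod R C) (d : ∀ n, I n ⟶ I (n + 1)) (η : Y ⟶ I 0),
    (∀ n, Injective (I n)) ∧
    Mod.IsMono η.hom ∧ Mod.Exact η.hom (d 0).hom ∧
    (∀ n, Mod.Exact (d n).hom (d (n + 1)).hom) ∧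
    ∀ n : ℕ, (n : ℕ∞) ≤ k → add J (I n)

/-! ### Duality and dualizing varieties -/

/-- The dual `X ↦ Hom_R(M(X), E)` of a `C`-module, a `Cᵒᵖ`-module. -/
def dual (E : ModuleCat.{u} R) (M : Mod R C) : Mod R Cᵒᵖ :=
  ⟨{ obj := fun X => ModuleCat.of R (M.obj.obj (unop X) →ₗ[R] E)
     map := fun f => ModuleCat.ofHom (LinearMap.lcomp R E (M.obj.map f.unop).hom)
     map_id := fun X => by
       ext g x
       simp
     map_comp := fun f g => by
       ext h x
       simp },
   { map_add := fun {X Y f g} => by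
       have := M.property.1
       ext h x
       simp },
   { map_smul := fun {X Y} f r => by
       have := M.property.2
       ext h x
       have e : M.obj.map ((r • f).unop) = r • M.obj.map f.unop :=
         M.obj.map_smul r f.unop
       simp [e] }⟩

/-- The contravariant functor `M ↦ Hom_R(M(-), E)` from `C`-modules to `Cᵒᵖ`-modules. -/
def dualFunctor (E : ModuleCat.{u} R) : (Mod R C)ᵒᵖ ⥤ Mod R Cᵒᵖ where
  obj M := dual E M.unop
  map {M N} f := ObjectProperty.homMk
    { app := fun X => ModuleCat.ofHom (LinearMap.lcomp R E (Mod.app f.unop (unop X)))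
      naturality := fun X Y g => by
        ext (h : M.unop.obj.obj (unop X) →ₗ[R] E)
        refine LinearMap.ext fun x => ?_
        exact congrArg h (LinearMap.congr_fun (congrArg ModuleCat.Hom.hom
          (f.unop.hom.naturality g.unop)) x).symm }

variable (R C) in
/-- An `R`-variety `C` (a small additive `R`-linear category in which idempotents split) is
dualizing if it is `Hom`-finite and the duality `Hom_R(-, E)`, where `E` is the injective envelope
of `R / rad R`, induces a duality between `mod(C)` and `mod(Cᵒᵖ)`. -/
structure IsDualizing [HasFiniteBiproducts C] [IsIdempotentComplete C] : Prop where
  homFinite : ∀ X Y : C, Module.Finite R (X ⟶ Y)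
  duality : ∃ (E : ModuleCat.{u} R) (i : ModuleCat.of R (R ⧸ Ring.jacobson R) ⟶ E),
    IsInjectiveEnvelope i ∧
    RestrictsToEquivalence (dualFunctor (C := C) E) (isFinPres R C).op (isFinPres R Cᵒᵖ)

/-! ### The functor `Hom(P, -)` -/

/-- The ring `R_P = End(P)ᵒᵖ`. -/
abbrev EndRing (P : FPMod R C) : Type u := (End P)ᵐᵒᵖ

/-- The functor `Hom(P, -) : mod(C) ⥤ Mod(R_P)`. -/
abbrev homFunctor (P : FPMod R C) : FPMod R C ⥤ ModuleCat.{u} (EndRing P) :=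
  preadditiveCoyonedaObj P

/-- The comparison map `ρ_{X,Y} : Hom(X, Y) → Hom_{R_P}(Hom(P, X), Hom(P, Y))`. -/
def rho (P X Y : FPMod R C) :
    (X ⟶ Y) →+ ((homFunctor P).obj X ⟶ (homFunctor P).obj Y) :=
  (homFunctor P).mapAddHom

end Modules

/-- `mod(S)`: the finitely generated left `S`-modules. -/
abbrev fgMod (S : Type u) [Ring S] : ObjectProperty (ModuleCat.{u} S) := ModuleCat.isFG S

/-- `proj(S)`: the finitely generated projective left `S`-modules. -/
def fgProj (S : Type u) [Ring S] : ObjectProperty (ModuleCat.{u} S) := fun M =>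
  Module.Finite S M ∧ Module.Projective S M

/-- `inj(S)`: the finitely generated injective left `S`-modules. -/
def fgInj (S : Type u) [Ring S] : ObjectProperty (ModuleCat.{u} S) := fun M =>
  Module.Finite S M ∧ Module.Injective S M

end DualizingVarieties

end

/-! Write `P = Hom(c, -)`. By Yoneda, `Hom(P, X)` is the value `X(c)`, so `Hom(P, -)` is exact, and
every `R_P`-linear map out of `Hom(P, Q)` with `Q` in `add(P)` is induced by a unique morphism
(`IsSummand.postcomp_injective`, `IsSummand.postcomp_surjective`).

The duality provides the mirror image. If `I` in `mod(C)` has dual `Hom(-, c)`, then `Hom(X, I)` is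
`Hom_R(Hom(P, X), E)` (`IsNakayama`, `Represents`). Hence `I` is injective, `Hom(P, I)` is an
injective `R_P`-module, and every `R_P`-linear map into `Hom(P, Y)` with `Y` in `add(I)` is induced
by a unique morphism. Duality also gives kernels and enough injectives in `mod(C)`, so presentations
and copresentations extend to full resolutions. The statements about `ρ` follow by diagram chases
along these.

For density, a finite presentation of an `R_P`-module `V` lifts to a morphism between powers of `P`,
and its cokernel is sent to `V` (`exists_PP_one`). Since all modules in play have finite length over
`R`, finitely many maps to `I` separate the elements of `Hom(P, X)`; two such steps give a
copresentation by powers of `I` whose kernel is sent to `Hom(P, X)` (`exists_II_one`). Projective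
and injective modules are then recognised by splitting.

It remains to see that `add(J) = add(I)`. The quotient `P / rad P` is finitely presented and embeds
in a power of `I` (`IsNakayama.exists_ker_eq_rad`), so it has an envelope `J`, a summand of that
power. Conversely, a nonzero cyclic `R_P`-module maps nontrivially to the top of `R_P`, hence to
`Hom(P, J)`. So maps `I ⟶ J` separate `Hom(P, I)`, and `I` embeds in a power of `J`
(`Represents.isSummand_of_envelope`). -/

noncomputable section

namespace DualizingVarieties

/-! ### Modules in terms of elements, Yoneda, finite presentation. -/

section ModuleBasics

variable {R : Type u} [CommRing R]
variable {C : Type u} [SmallCategory C] [Preadditive C] [Linear R C]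

namespace Mod

/-- The `R`-linear action of a morphism of `C` on a `C`-module. -/
def act (M : Mod R C) {X Y : C} (f : X ⟶ Y) : M.obj.obj X →ₗ[R] M.obj.obj Y :=
  (M.obj.map f).hom

@[simp]
theorem act_id (M : Mod R C) {X : C} (x : M.obj.obj X) : M.act (𝟙 X) x = x := by
  simp [act]

theorem act_comp (M : Mod R C) {X Y Z : C} (f : X ⟶ Y) (g : Y ⟶ Z) (x : M.obj.obj X) :
    M.act (f ≫ g) x = M.act g (M.act f x) := by
  simp [act]

theorem act_add (M : Mod R C) {X Y : C} (f g : X ⟶ Y) (x : M.obj.obj X) :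
    M.act (f + g) x = M.act f x + M.act g x := by
  have := M.property.1
  simp [act, Functor.map_add]

theorem act_smul (M : Mod R C) {X Y : C} (r : R) (f : X ⟶ Y) (x : M.obj.obj X) :
    M.act (r • f) x = r • M.act f x := by
  have := M.property.2
  simp [act, Functor.map_smul]

/-- The action as a linear map in the morphism. -/
def orbit (M : Mod R C) {X : C} (x : M.obj.obj X) (Y : C) : (X ⟶ Y) →ₗ[R] M.obj.obj Y where
  toFun f := M.act f x
  map_add' f g := M.act_add f g x
  map_smul' r f := M.act_smul r f x

@[simp]
theorem act_zero (M : Mod R C) {X Y : C} (x : M.obj.obj X) : M.act (0 : X ⟶ Y) x = 0 :=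
  map_zero (M.orbit x Y)

theorem app_act {M N : Mod R C} (u : M ⟶ N) {X Y : C} (f : X ⟶ Y) (x : M.obj.obj X) :
    app u Y (M.act f x) = N.act f (app u X x) :=
  LinearMap.congr_fun (congrArg ModuleCat.Hom.hom (u.hom.naturality f)) x

@[ext]
theorem hom_ext {M N : Mod R C} {u v : M ⟶ N} (h : ∀ X x, app u X x = app v X x) : u = v := by
  apply InducedCategory.hom_ext
  ext X x
  exact h X x

@[simp]
theorem app_id (M : Mod R C) (X : C) (x : M.obj.obj X) : app (𝟙 M) X x = x := rfl

@[simp]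
theorem app_comp {L M N : Mod R C} (u : L ⟶ M) (v : M ⟶ N) (X : C) (x : L.obj.obj X) :
    app (u ≫ v) X x = app v X (app u X x) := rfl

/-- A morphism of `C`-modules from a natural family of linear maps. -/
def mkHom {M N : Mod R C} (t : ∀ X : C, M.obj.obj X →ₗ[R] N.obj.obj X)
    (ht : ∀ ⦃X Y : C⦄ (f : X ⟶ Y) (x : M.obj.obj X), t Y (M.act f x) = N.act f (t X x)) :
    M ⟶ N :=
  ObjectProperty.homMk
    { app := fun X => ModuleCat.ofHom (t X)
      naturality := fun X Y f => by
        ext x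
        exact ht f x }

@[simp]
theorem app_mkHom {M N : Mod R C} (t : ∀ X : C, M.obj.obj X →ₗ[R] N.obj.obj X)
    (ht : ∀ ⦃X Y : C⦄ (f : X ⟶ Y) (x : M.obj.obj X), t Y (M.act f x) = N.act f (t X x))
    (X : C) (x : M.obj.obj X) : app (mkHom t ht) X x = t X x := rfl

theorem isIso_of_bijective {M N : Mod R C} (u : M ⟶ N)
    (h : ∀ X, Function.Bijective (app u X)) : IsIso u := by
  let e X := LinearEquiv.ofBijective (app u X) (h X)
  have he X (x : M.obj.obj X) : e X x = app u X x := rfl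
  refine ⟨mkHom (fun X => (e X).symm.toLinearMap) fun X Y f x => ?_, ?_, ?_⟩
  · apply (e Y).injective
    refine ((e Y).apply_symm_apply _).trans ?_
    rw [he]
    refine (congrArg (N.act f) ?_).trans (app_act u f _).symm
    exact ((e X).apply_symm_apply x).symm
  · ext X x
    exact (e X).symm_apply_apply x
  · ext X x
    exact (e X).apply_symm_apply x

theorem app_bijective {M N : Mod R C} (u : M ⟶ N) [IsIso u] (X : C) :
    Function.Bijective (app u X) := by
  refine Function.bijective_iff_has_inverse.2 ⟨app (inv u) X, fun x => ?_, fun x => ?_⟩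
  · rw [← app_comp, IsIso.hom_inv_id, app_id]
  · rw [← app_comp, IsIso.inv_hom_id, app_id]

theorem exists_lift {K M N : Mod R C} (i : K ⟶ N) (hi : IsMono i) (f : M ⟶ N)
    (h : ∀ X x, app f X x ∈ LinearMap.range (app i X)) : ∃ g : M ⟶ K, g ≫ i = f := by
  let e X := LinearEquiv.ofInjective (app i X) (hi X)
  have he X y : app i X ((e X).symm y) = y.1 :=
    congrArg Subtype.val ((e X).apply_symm_apply y)
  refine ⟨mkHom (fun X => (e X).symm.toLinearMap ∘ₗ (app f X).codRestrict _ (h X))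
    fun X Y a x => hi Y ?_, ?_⟩
  · rw [app_act]
    simp [he, app_act]
  · ext X x
    simp [he]

theorem exists_desc {M N K : Mod R C} (p : M ⟶ N) (hp : IsEpi p) (f : M ⟶ K)
    (h : ∀ X x, app p X x = 0 → app f X x = 0) : ∃ g : N ⟶ K, p ≫ g = f := by
  let e X := (app p X).quotKerEquivOfSurjective (hp X)
  have he X x : (e X).symm (app p X x) = Submodule.Quotient.mk x := by
    rw [LinearEquiv.symm_apply_eq]
    rfl
  let t X : N.obj.obj X →ₗ[R] K.obj.obj X :=
    (LinearMap.ker (app p X)).liftQ (app f X) (h X) ∘ₗ (e X).symm.toLinearMap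
  have ht X x : t X (app p X x) = app f X x := by
    simp only [t, LinearMap.comp_apply, LinearEquiv.coe_coe, he]
    exact Submodule.liftQ_apply _ _ _
  refine ⟨mkHom t fun X Y a y => ?_, ?_⟩
  · obtain ⟨x, rfl⟩ := hp X y
    rw [← app_act, ht, ht, app_act]
  · ext X x
    simp [ht]

/-- The morphism `Hom(X, -) ⟶ M` given by an element of `M(X)`. -/
def ofElt {M : Mod R C} {X : C} (m : M.obj.obj X) : rep R X ⟶ M :=
  mkHom (fun Y => M.orbit m Y) fun _ _ f g => M.act_comp g f m

theorem app_rep {M : Mod R C} {X Y : C} (u : rep R X ⟶ M) (f : X ⟶ Y) :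
    app u Y f = M.act f (app u X (𝟙 X)) :=
  (congrArg (app u Y) (Category.id_comp f).symm).trans (app_act u f (𝟙 X))

theorem rep_hom_ext {M : Mod R C} {X : C} {u v : rep R X ⟶ M}
    (h : app u X (𝟙 X) = app v X (𝟙 X)) : u = v := by
  ext Y f
  exact (app_rep u f).trans ((congrArg _ h).trans (app_rep v f).symm)

end Mod

/-- `M` is generated by a single element of a value `M(X)`. -/
def Mod.IsGeneratedBy (M : Mod R C) {X : C} (m : M.obj.obj X) : Prop :=
  ∀ (Y : C) (y : M.obj.obj Y), ∃ f : X ⟶ Y, M.act f m = y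

/-- By Yoneda, a presentation amounts to a generator `m` and a single relation `k`, exactness saying
that the morphisms killing `m` are those factoring through `k`. -/
theorem isFinPres_iff (M : Mod R C) : isFinPres R C M ↔
    ∃ (X₀ X₁ : C) (k : X₁ ⟶ X₀) (m : M.obj.obj X₁), M.IsGeneratedBy m ∧
      ∀ (Y : C) (f : X₁ ⟶ Y), M.act f m = 0 ↔ ∃ g : X₀ ⟶ Y, k ≫ g = f := by
  constructor
  · rintro ⟨X₀, X₁, φ, π, h, hπ⟩
    refine ⟨X₀, X₁, Mod.app φ X₀ (𝟙 X₀), Mod.app π X₁ (𝟙 X₁), fun Y y => ?_, fun Y f => ?_⟩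
    · obtain ⟨f, hf⟩ := hπ Y y
      exact ⟨f, (Mod.app_rep π f).symm.trans hf⟩
    · rw [← Mod.app_rep, h Y f]
      exact exists_congr fun g => by rw [Mod.app_rep φ g]; rfl
  · rintro ⟨X₀, X₁, k, m, hm, hk⟩
    refine ⟨X₀, X₁, Mod.ofElt (M := rep R X₁) k, Mod.ofElt m, fun Y f => ?_, hm⟩
    exact hk Y f

theorem isFinPres_of_iso {M N : Mod R C} (u : M ⟶ N) [IsIso u] (hM : isFinPres R C M) :
    isFinPres R C N := by
  obtain ⟨X₀, X₁, φ, π, h, hπ⟩ := hM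
  refine ⟨X₀, X₁, φ, π ≫ u, fun Y f => ?_, fun Y => (Mod.app_bijective u Y).2.comp (hπ Y)⟩
  rw [← h Y f]
  exact (map_eq_zero_iff _ (Mod.app_bijective u Y).1)

theorem exists_isGeneratedBy {M : Mod R C} (hM : isFinPres R C M) :
    ∃ (X : C) (m : M.obj.obj X), M.IsGeneratedBy m := by
  obtain ⟨_, X, _, m, hm, _⟩ := (isFinPres_iff M).1 hM
  exact ⟨X, m, hm⟩

/-- Writing the image of the generator `l` as `a` applied to the generator of `M`, the quotient has
the same generator and the relations `k` and `a` together, that is `Y₁ ⟶ Y₀ ⊞ X`. Of `L` only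
cyclicity matters. -/
theorem isFinPres_coker [HasBinaryBiproducts C] {L M N : Mod R C} {X : C} {l : L.obj.obj X}
    (hL : L.IsGeneratedBy l) (hM : isFinPres R C M) (u : L ⟶ M) (q : M ⟶ N)
    (hq : Mod.IsEpi q) (huq : Mod.Exact u q) : isFinPres R C N := by
  obtain ⟨Y₀, Y₁, k, m, hm, hk⟩ := (isFinPres_iff M).1 hM
  obtain ⟨a, ha⟩ := hm X (Mod.app u X l)
  refine (isFinPres_iff N).2 ⟨Y₀ ⊞ X, Y₁, biprod.lift k a, Mod.app q Y₁ m, fun Z z => ?_,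
    fun Z f => ?_⟩
  · obtain ⟨y, rfl⟩ := hq Z z
    obtain ⟨f, rfl⟩ := hm Z y
    exact ⟨f, (Mod.app_act q f m).symm⟩
  · rw [← Mod.app_act, huq Z]
    constructor
    · rintro ⟨x, hx⟩
      obtain ⟨h, rfl⟩ := hL Z x
      have : M.act (f - a ≫ h) m = 0 := by
        rw [sub_eq_add_neg, M.act_add, ← neg_one_smul R, M.act_smul, M.act_comp, ha,
          ← Mod.app_act, hx]
        simp
      obtain ⟨g, hg⟩ := (hk Z _).1 this
      exact ⟨biprod.desc g h, by simp [hg]⟩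
    · rintro ⟨g, rfl⟩
      refine ⟨L.act (biprod.inr ≫ g) l, ?_⟩
      rw [Mod.app_act, ← ha, ← M.act_comp]
      have h0 : M.act (k ≫ biprod.inl ≫ g) m = 0 := (hk Z _).2 ⟨_, rfl⟩
      rw [biprod.lift_eq, Preadditive.add_comp, M.act_add, Category.assoc, Category.assoc, h0,
        zero_add]

end ModuleBasics

/-! ### Submodules, quotients, kernels, images and products. -/

section Constructions

variable {R : Type u} [CommRing R]
variable {C : Type u} [SmallCategory C] [Preadditive C] [Linear R C]

/-- The projection onto the quotient by a submodule. -/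
def Sub.mkQ {M : Mod R C} (N : Sub M) : M ⟶ N.quotient :=
  Mod.mkHom (N := N.quotient) (fun X => (N.carrier X).mkQ) fun _ _ _ _ => rfl

theorem Sub.mkQ_isEpi {M : Mod R C} (N : Sub M) : Mod.IsEpi N.mkQ :=
  fun X => (N.carrier X).mkQ_surjective

theorem Sub.app_mkQ_eq_zero_iff {M : Mod R C} (N : Sub M) {X : C} (x : M.obj.obj X) :
    Mod.app N.mkQ X x = 0 ↔ x ∈ N.carrier X :=
  Submodule.Quotient.mk_eq_zero _

/-- A submodule as a `C`-module. -/
def Sub.toMod {M : Mod R C} (N : Sub M) : Mod R C :=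
  ⟨{ obj := fun X => ModuleCat.of R (N.carrier X)
     map := fun {X Y} f => ModuleCat.ofHom
       ((M.obj.map f).hom.restrict (fun _ hx => N.map_mem f hx))
     map_id := fun X => by
       refine ModuleCat.hom_ext (LinearMap.ext fun x : N.carrier _ => ?_)
       exact Subtype.ext (M.act_id x.1)
     map_comp := fun f g => by
       refine ModuleCat.hom_ext (LinearMap.ext fun x : N.carrier _ => ?_)
       exact Subtype.ext (M.act_comp f g x.1) },
   { map_add := fun {X Y f g} => by
       refine ModuleCat.hom_ext (LinearMap.ext fun x : N.carrier _ => ?_)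
       exact Subtype.ext (M.act_add f g x.1) },
   { map_smul := fun {X Y} f r => by
       refine ModuleCat.hom_ext (LinearMap.ext fun x : N.carrier _ => ?_)
       exact Subtype.ext (M.act_smul r f x.1) }⟩

/-- The inclusion of a submodule. -/
def Sub.incl {M : Mod R C} (N : Sub M) : N.toMod ⟶ M :=
  Mod.mkHom (M := N.toMod) (fun X => (N.carrier X).subtype) fun _ _ _ _ => rfl

theorem Sub.incl_isMono {M : Mod R C} (N : Sub M) : Mod.IsMono N.incl :=
  fun X => (N.carrier X).injective_subtype

/-- The kernel of a morphism as a submodule. -/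
def Mod.ker {M N : Mod R C} (u : M ⟶ N) : Sub M where
  carrier X := LinearMap.ker (Mod.app u X)
  map_mem f x hx := by
    have hx : Mod.app u _ x = 0 := hx
    change Mod.app u _ (M.act f x) = 0
    rw [Mod.app_act, hx, map_zero]

/-- The image of a morphism as a submodule. -/
def Mod.range {M N : Mod R C} (u : M ⟶ N) : Sub N where
  carrier X := LinearMap.range (Mod.app u X)
  map_mem f x hx := by
    obtain ⟨y, rfl⟩ := hx
    exact ⟨M.act f y, Mod.app_act u f y⟩

theorem Mod.exact_incl_ker {M N : Mod R C} (u : M ⟶ N) : Mod.Exact (Mod.ker u).incl u :=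
  fun _ x => ⟨fun h => ⟨⟨x, h⟩, rfl⟩, fun ⟨y, hy⟩ => hy ▸ y.2⟩

theorem Mod.exact_mkQ_range {M N : Mod R C} (u : M ⟶ N) : Mod.Exact u (Mod.range u).mkQ :=
  fun _ x => Sub.app_mkQ_eq_zero_iff (Mod.range u) x

/-- The product of two `C`-modules. -/
def Mod.prod (M N : Mod R C) : Mod R C :=
  ⟨{ obj := fun X => ModuleCat.of R (M.obj.obj X × N.obj.obj X)
     map := fun {X Y} f => ModuleCat.ofHom (LinearMap.prodMap (M.act f) (N.act f))
     map_id := fun X => by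
       refine ModuleCat.hom_ext (LinearMap.ext fun x : M.obj.obj _ × N.obj.obj _ => ?_)
       exact Prod.ext (M.act_id x.1) (N.act_id x.2)
     map_comp := fun f g => by
       refine ModuleCat.hom_ext (LinearMap.ext fun x : M.obj.obj _ × N.obj.obj _ => ?_)
       exact Prod.ext (M.act_comp f g x.1) (N.act_comp f g x.2) },
   { map_add := fun {X Y f g} => by
       refine ModuleCat.hom_ext (LinearMap.ext fun x : M.obj.obj _ × N.obj.obj _ => ?_)
       exact Prod.ext (M.act_add f g x.1) (N.act_add f g x.2) },
   { map_smul := fun {X Y} f r => by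
       refine ModuleCat.hom_ext (LinearMap.ext fun x : M.obj.obj _ × N.obj.obj _ => ?_)
       exact Prod.ext (M.act_smul r f x.1) (N.act_smul r f x.2) }⟩

theorem isFinPres_prod [HasBinaryBiproducts C] {M N : Mod R C} (hM : isFinPres R C M)
    (hN : isFinPres R C N) : isFinPres R C (M.prod N) := by
  obtain ⟨X₀, X₁, k, m, hm, hk⟩ := (isFinPres_iff M).1 hM
  obtain ⟨Y₀, Y₁, l, n, hn, hl⟩ := (isFinPres_iff N).1 hN
  refine (isFinPres_iff _).2 ⟨X₀ ⊞ Y₀, X₁ ⊞ Y₁, biprod.map k l,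
    (M.act biprod.inl m, N.act biprod.inr n), fun Z z => ?_, fun Z f => ?_⟩
  · obtain ⟨f, hf⟩ := hm Z z.1
    obtain ⟨g, hg⟩ := hn Z z.2
    refine ⟨biprod.desc f g, Prod.ext ?_ ?_⟩
    · change M.act _ (M.act _ _) = _
      rw [← M.act_comp, biprod.inl_desc, hf]
    · change N.act _ (N.act _ _) = _
      rw [← N.act_comp, biprod.inr_desc, hg]
  · have h1 : M.act f (M.act biprod.inl m) = 0 ↔ ∃ g, k ≫ g = biprod.inl ≫ f := by
      rw [← M.act_comp]
      exact hk Z (biprod.inl ≫ f)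
    have h2 : N.act f (N.act biprod.inr n) = 0 ↔ ∃ g, l ≫ g = biprod.inr ≫ f := by
      rw [← N.act_comp]
      exact hl Z (biprod.inr ≫ f)
    refine (Prod.ext_iff (x := (M.act f (M.act biprod.inl m), N.act f (N.act biprod.inr n)))
      (y := 0)).trans ?_
    refine (and_congr h1 h2).trans ⟨?_, ?_⟩
    · rintro ⟨⟨g, hg⟩, ⟨h, hh⟩⟩
      exact ⟨biprod.desc g h, by apply biprod.hom_ext' <;> simp [hg, hh]⟩
    · rintro ⟨g, rfl⟩
      exact ⟨⟨biprod.inl ≫ g, by simp⟩, ⟨biprod.inr ≫ g, by simp⟩⟩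

end Constructions

/-! ### The category `mod(C)`: monomorphisms, epimorphisms, cokernels, biproducts. -/

section FinPres

variable {R : Type u} [CommRing R]
variable {C : Type u} [SmallCategory C] [Preadditive C] [Linear R C]

namespace FPMod

open ZeroObject

@[ext]
theorem hom_ext {X Y : FPMod R C} {u v : X ⟶ Y}
    (h : ∀ c x, Mod.app u.hom c x = Mod.app v.hom c x) : u = v :=
  InducedCategory.hom_ext (Mod.hom_ext h)

/-- The morphism from a representable given by an element. -/
def ofElt {X : FPMod R C} {c : C} (x : X.obj.obj.obj c) : fpRep R c ⟶ X :=
  ObjectProperty.homMk (Mod.ofElt x)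

/-- The element corresponding to a morphism from a representable. -/
def elt {X : FPMod R C} {c : C} (u : fpRep R c ⟶ X) : X.obj.obj.obj c := Mod.app u.hom c (𝟙 c)

@[simp]
theorem elt_ofElt {X : FPMod R C} {c : C} (x : X.obj.obj.obj c) : elt (ofElt x) = x :=
  X.obj.act_id x

theorem elt_injective {X : FPMod R C} {c : C} : Function.Injective (elt (X := X) (c := c)) :=
  fun _ _ h => InducedCategory.hom_ext (Mod.rep_hom_ext h)

@[simp]
theorem ofElt_elt {X : FPMod R C} {c : C} (u : fpRep R c ⟶ X) : ofElt (elt u) = u :=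
  elt_injective (elt_ofElt _)

theorem elt_comp {X Y : FPMod R C} {c : C} (u : fpRep R c ⟶ X) (v : X ⟶ Y) :
    elt (u ≫ v) = Mod.app v.hom c (elt u) := rfl

theorem elt_ofElt_comp {X : FPMod R C} {c d : C} (f : c ⟶ d) (u : fpRep R c ⟶ X) :
    elt ((ofElt (X := fpRep R c) f : fpRep R d ⟶ fpRep R c) ≫ u) = X.obj.act f (elt u) :=
  (congrArg (Mod.app u.hom d) (elt_ofElt (X := fpRep R c) f)).trans (Mod.app_rep u.hom f)

/-- Yoneda's lemma. -/
def eltEquiv (X : FPMod R C) (c : C) : (fpRep R c ⟶ X) ≃ₗ[R] X.obj.obj.obj c where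
  toFun := elt
  map_add' _ _ := rfl
  map_smul' _ _ := rfl
  invFun := ofElt
  left_inv := ofElt_elt
  right_inv := elt_ofElt

theorem exists_lift {K M N : FPMod R C} (i : K ⟶ N) (hi : Mod.IsMono i.hom) (f : M ⟶ N)
    (h : ∀ c x, Mod.app f.hom c x ∈ LinearMap.range (Mod.app i.hom c)) :
    ∃ g : M ⟶ K, g ≫ i = f := by
  obtain ⟨g, hg⟩ := Mod.exists_lift i.hom hi f.hom h
  exact ⟨ObjectProperty.homMk g, InducedCategory.hom_ext hg⟩

theorem exists_desc {M N K : FPMod R C} (p : M ⟶ N) (hp : Mod.IsEpi p.hom) (f : M ⟶ K)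
    (h : ∀ c x, Mod.app p.hom c x = 0 → Mod.app f.hom c x = 0) :
    ∃ g : N ⟶ K, p ≫ g = f := by
  obtain ⟨g, hg⟩ := Mod.exists_desc p.hom hp f.hom h
  exact ⟨ObjectProperty.homMk g, InducedCategory.hom_ext hg⟩

theorem app_eq_zero_of_comp_eq_zero {L M N : FPMod R C} {u : L ⟶ M} {v : M ⟶ N}
    (h : u ≫ v = 0) (c : C) (x : L.obj.obj.obj c) :
    Mod.app v.hom c (Mod.app u.hom c x) = 0 := by
  rw [← Mod.app_comp, ← ObjectProperty.FullSubcategory.comp_hom, h]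
  rfl

theorem comp_eq_zero_of_exact {L M N : FPMod R C} {u : L ⟶ M} {v : M ⟶ N}
    (h : Mod.Exact u.hom v.hom) : u ≫ v = 0 := by
  ext c x
  exact (h c _).2 ⟨x, rfl⟩

theorem exists_lift_of_exact {K M N L : FPMod R C} {i : K ⟶ N} (hi : Mod.IsMono i.hom)
    {p : N ⟶ L} (hp : Mod.Exact i.hom p.hom) (f : M ⟶ N) (h : f ≫ p = 0) :
    ∃ g : M ⟶ K, g ≫ i = f :=
  exists_lift i hi f fun c x => (hp c _).1 (app_eq_zero_of_comp_eq_zero h c x)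

theorem exists_desc_of_exact {L M N K : FPMod R C} {i : L ⟶ M} {p : M ⟶ N}
    (hp : Mod.IsEpi p.hom) (hi : Mod.Exact i.hom p.hom) (f : M ⟶ K) (h : i ≫ f = 0) :
    ∃ g : N ⟶ K, p ≫ g = f :=
  exists_desc p hp f fun c x hx => by
    obtain ⟨y, rfl⟩ := (hi c x).1 hx
    exact app_eq_zero_of_comp_eq_zero h c y

/-- Elements are morphisms from representables, which lie in `mod(C)`; so no kernels are needed. -/
theorem mono_iff {X Y : FPMod R C} (u : X ⟶ Y) : Mono u ↔ Mod.IsMono u.hom := by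
  constructor
  · intro _ c x y h
    have : ofElt x ≫ u = ofElt y ≫ u := elt_injective (by simpa [elt_comp] using h)
    simpa using congrArg elt ((cancel_mono u).1 this)
  · intro h
    refine ⟨fun f g hfg => ?_⟩
    ext c x
    apply h c
    rw [← Mod.app_comp, ← Mod.app_comp, ← ObjectProperty.FullSubcategory.comp_hom, hfg]
    rfl

theorem mono_iff_comp_eq_zero {X Y : FPMod R C} (u : X ⟶ Y) :
    Mono u ↔ ∀ (c : C) (f : fpRep R c ⟶ X), f ≫ u = 0 → f = 0 := by
  constructor
  · intro _ c f hf
    exact zero_of_comp_mono u hf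
  · intro h
    refine (mono_iff u).2 fun c => (injective_iff_map_eq_zero _).2 fun x hx => ?_
    have := h c (ofElt x) (elt_injective (by rwa [elt_comp, elt_ofElt]))
    exact (elt_ofElt x).symm.trans (congrArg elt this)

theorem epi_of_isEpi {X Y : FPMod R C} {u : X ⟶ Y} (h : Mod.IsEpi u.hom) : Epi u := by
  refine ⟨fun f g hfg => ?_⟩
  ext c y
  obtain ⟨x, rfl⟩ := h c y
  rw [← Mod.app_comp, ← Mod.app_comp, ← ObjectProperty.FullSubcategory.comp_hom, hfg]
  rfl

theorem exists_isEpi_fpRep (X : FPMod R C) :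
    ∃ (c : C) (p : fpRep R c ⟶ X), Mod.IsEpi p.hom := by
  obtain ⟨c, x, hx⟩ := exists_isGeneratedBy X.property
  exact ⟨c, ofElt x, hx⟩

section Coker

variable [HasBinaryBiproducts C]

theorem exists_coker {X Y : FPMod R C} (u : X ⟶ Y) :
    ∃ (Z : FPMod R C) (q : Y ⟶ Z), Mod.IsEpi q.hom ∧ Mod.Exact u.hom q.hom := by
  obtain ⟨c, x, hx⟩ := exists_isGeneratedBy X.property
  exact ⟨⟨(Mod.range u.hom).quotient, isFinPres_coker hx Y.property u.hom _ (Sub.mkQ_isEpi _)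
    (Mod.exact_mkQ_range _)⟩, ObjectProperty.homMk (Mod.range u.hom).mkQ, Sub.mkQ_isEpi _,
    Mod.exact_mkQ_range _⟩

/-- The pointwise cokernel stays in `mod(C)`, and its projection vanishes when `u` is an
epimorphism. -/
theorem isEpi_of_epi {X Y : FPMod R C} (u : X ⟶ Y) [Epi u] : Mod.IsEpi u.hom := by
  obtain ⟨Z, q, hq, huq⟩ := exists_coker u
  have : q = 0 := zero_of_epi_comp u (comp_eq_zero_of_exact huq)
  intro c y
  exact (huq c y).1 (by rw [this]; rfl)

instance projective_fpRep (c : C) : Projective (fpRep R c) where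
  factors f e _ := by
    obtain ⟨x, hx⟩ := isEpi_of_epi e c (elt f)
    exact ⟨ofElt x, elt_injective (by rw [elt_comp, elt_ofElt, hx])⟩

instance hasBinaryBiproducts : HasBinaryBiproducts (FPMod R C) where
  has_binary_biproduct X Y := by
    let b : BinaryBicone X Y :=
      { pt := ⟨X.obj.prod Y.obj, isFinPres_prod X.property Y.property⟩
        fst := ObjectProperty.homMk
          (Mod.mkHom (M := X.obj.prod Y.obj) (fun c => LinearMap.fst R _ _) fun _ _ _ _ => rfl)
        snd := ObjectProperty.homMk
          (Mod.mkHom (M := X.obj.prod Y.obj) (fun c => LinearMap.snd R _ _) fun _ _ _ _ => rfl)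
        inl := ObjectProperty.homMk
          (Mod.mkHom (N := X.obj.prod Y.obj) (fun c => LinearMap.inl R _ _)
            fun _ _ f _ => Prod.ext rfl (map_zero (Y.obj.act f)).symm)
        inr := ObjectProperty.homMk
          (Mod.mkHom (N := X.obj.prod Y.obj) (fun c => LinearMap.inr R _ _)
            fun _ _ f _ => Prod.ext (map_zero (X.obj.act f)).symm rfl)
        inl_fst := rfl
        inl_snd := rfl
        inr_fst := rfl
        inr_snd := rfl }
    refine hasBinaryBiproduct_of_total b ?_
    ext c x
    exact Prod.ext (add_zero x.1) (zero_add x.2)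

end Coker

instance hasFiniteBiproducts [HasFiniteBiproducts C] : HasFiniteBiproducts (FPMod R C) := by
  have : HasBinaryBiproducts C := hasBinaryBiproducts_of_finite_biproducts C
  have : HasZeroObject (FPMod R C) := by
    refine ⟨⟨fpRep R (0 : C), (IsZero.iff_id_eq_zero _).2 ?_⟩⟩
    exact elt_injective ((isZero_zero C).eq_of_src _ _)
  have := hasFiniteProducts_of_has_binary_and_terminal (C := FPMod R C)
  exact HasFiniteBiproducts.of_hasFiniteProducts

end FPMod

end FinPres

/-! ### Two facts on artinian rings and modules. -/

section RingTheory

/-- A nonzero cyclic module `A / K` has a nonzero map to `A / rad A`, sending `1` to the class of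
`s`. In the semisimple ring `A / rad A` the image of a maximal left ideal containing `K` has a
complement, and `s` lifts the component of `1` there. -/
theorem exists_notMem_jacobson_mul_mem {A : Type u} [Ring A] [IsArtinianRing A] (K : Ideal A)
    (hK : K ≠ ⊤) : ∃ s, s ∉ Ring.jacobson A ∧ ∀ b ∈ K, b * s ∈ Ring.jacobson A := by
  obtain ⟨m, hm, hKm⟩ := K.exists_le_maximal hK
  let q := Ideal.Quotient.mk (Ring.jacobson A)
  have hq : Function.Surjective q := Ideal.Quotient.mk_surjective
  obtain ⟨L, hL⟩ := exists_isCompl (m.map q)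
  obtain ⟨x, hx, y, hy, hxy⟩ := Submodule.mem_sup.1
    (hL.sup_eq_top ▸ Submodule.mem_top : (1 : A ⧸ Ring.jacobson A) ∈ m.map q ⊔ L)
  obtain ⟨s, rfl⟩ := hq y
  have hker {a : A} : q a = 0 ↔ a ∈ Ring.jacobson A := Ideal.Quotient.eq_zero_iff_mem
  refine ⟨s, fun hs => ?_, fun b hb => ?_⟩
  · rw [hker.2 hs, add_zero] at hxy
    subst hxy
    obtain ⟨a, ha, ha1⟩ := (Ideal.mem_map_iff_of_surjective q hq).1 hx
    have h1 : a - 1 ∈ Ring.jacobson A := hker.1 (by rw [map_sub, ha1, map_one, sub_self])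
    have h2 : Ring.jacobson A ≤ m := by
      rw [Ring.jacobson_eq_sInf_isMaximal]
      exact sInf_le hm
    exact hm.ne_top ((Ideal.eq_top_iff_one m).2 (by simpa using m.sub_mem ha (h2 h1)))
  · have hb' : q b ∈ m.map q := Ideal.mem_map_of_mem q (hKm hb)
    have hbs : q b * q s ∈ m.map q := by
      rw [← eq_sub_iff_add_eq'] at hxy
      rw [hxy, mul_sub, mul_one]
      exact Submodule.sub_mem _ hb' (Ideal.mul_mem_left _ _ hx)
    rw [← hker, map_mul]
    exact (Submodule.disjoint_def.1 hL.disjoint) _ hbs (L.mul_mem_left _ hy)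

/-- A minimal finite intersection of the `K k` does not shrink when a further `K k` is added, so it
is the full intersection. -/
theorem exists_fin_forall_eq_zero {R : Type*} [Ring R] {M : Type*} [AddCommGroup M] [Module R M]
    [IsArtinian R M] {κ : Type*} (K : κ → Submodule R M) (N : Submodule R M)
    (h : ∀ x, (∀ k, x ∈ K k) → x ∈ N) :
    ∃ (n : ℕ) (k : Fin n → κ), ∀ x, (∀ i, x ∈ K (k i)) → x ∈ N := by
  classical
  obtain ⟨_, ⟨t, rfl⟩, ht⟩ := (wellFounded_lt (α := Submodule R M)).has_min
    (Set.range fun t : Finset κ => t.inf K) (Set.range_nonempty _)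
  refine ⟨t.card, fun i => t.equivFin.symm i, fun x hx => h x fun k => ?_⟩
  have hle : t.inf K ≤ K k := by
    have h1 : (insert k t).inf K ≤ t.inf K := Finset.inf_mono (Finset.subset_insert k t)
    rw [← eq_of_le_of_not_lt h1 (ht _ ⟨insert k t, rfl⟩)]
    exact Finset.inf_le (Finset.mem_insert_self k t)
  refine hle ((Submodule.mem_finsetInf).2 fun j hj => ?_)
  simpa using hx (t.equivFin ⟨j, hj⟩)

end RingTheory

/-! ### The module `E` as an injective cogenerator. -/

section Cogenerator

variable {R : Type u} [CommRing R] [IsArtinianRing R]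

omit [IsArtinianRing R] in
/-- Injectivity of an object of `ModuleCat R` in terms of linear maps. -/
theorem exists_extend {E : ModuleCat.{u} R} (hE : Injective E) {V W : Type u} [AddCommGroup V]
    [Module R V] [AddCommGroup W] [Module R W] (i : V →ₗ[R] W) (hi : Function.Injective i)
    (φ : V →ₗ[R] E) : ∃ ψ : W →ₗ[R] E, ψ ∘ₗ i = φ := by
  have : Mono (ModuleCat.ofHom i) := (ModuleCat.mono_iff_injective _).2 hi
  exact ⟨(Injective.factorThru (ModuleCat.ofHom φ) (ModuleCat.ofHom i)).hom,
    congrArg ModuleCat.Hom.hom (Injective.comp_factorThru (ModuleCat.ofHom φ) (ModuleCat.ofHom i))⟩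

/-- Functionals with values in `E` separate points from submodules. -/
def IsCogenerator (E : ModuleCat.{u} R) : Prop :=
  ∀ (V : Type u) [AddCommGroup V] [Module R V] (N : Submodule R V) (v : V),
    (∀ φ : V →ₗ[R] E, (∀ x ∈ N, φ x = 0) → φ v = 0) → v ∈ N

/-- The cyclic submodule of `V ⧸ N` generated by a nonzero class has a nonzero map to `R / rad R`,
which embeds in `E`; injectivity of `E` extends it to `V ⧸ N`. -/
theorem isCogenerator_of_isInjectiveEnvelope {E : ModuleCat.{u} R}
    {i : ModuleCat.of R (R ⧸ Ring.jacobson R) ⟶ E} (hi : IsInjectiveEnvelope i) :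
    IsCogenerator E := by
  intro V _ _ N v h
  by_contra hv
  let v' : V ⧸ N := N.mkQ v
  have hv' : v' ≠ 0 := fun h => hv ((Submodule.Quotient.mk_eq_zero N).1 h)
  obtain ⟨s, hs, hsK⟩ := exists_notMem_jacobson_mul_mem
    (LinearMap.ker (LinearMap.toSpanSingleton R (V ⧸ N) v')) (by
      rw [Ne, Ideal.eq_top_iff_one]
      simpa using hv')
  let e := (LinearMap.toSpanSingleton R (V ⧸ N) v').quotKerEquivRange
  let f : R →ₗ[R] (R ⧸ Ring.jacobson R) :=
    LinearMap.toSpanSingleton R _ (Submodule.Quotient.mk s)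
  have hf : LinearMap.ker (LinearMap.toSpanSingleton R (V ⧸ N) v') ≤ LinearMap.ker f :=
    fun b hb => (Submodule.Quotient.mk_eq_zero _).2 (hsK b hb)
  obtain ⟨ψ, hψ⟩ := exists_extend hi.injective (Submodule.subtype _) (Submodule.injective_subtype _)
    (i.hom ∘ₗ (Submodule.liftQ _ f hf) ∘ₗ e.symm.toLinearMap)
  have h1 : ψ v' = i.hom (Submodule.Quotient.mk s) := by
    have h2 : e (Submodule.Quotient.mk 1) = ⟨v', 1, one_smul _ _⟩ := Subtype.ext (one_smul R v')
    have h3 := LinearMap.congr_fun hψ ⟨v', 1, one_smul _ _⟩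
    rw [← h2] at h3
    simp only [LinearMap.comp_apply, LinearEquiv.coe_coe, e.symm_apply_apply] at h3
    rw [h2] at h3
    refine h3.trans (congrArg i.hom ?_)
    exact one_smul R (Submodule.Quotient.mk s : R ⧸ Ring.jacobson R)
  have h4 : ψ v' = 0 := h (ψ ∘ₗ N.mkQ) fun x hx => by
    rw [LinearMap.comp_apply, Submodule.mkQ_apply, (Submodule.Quotient.mk_eq_zero N).2 hx, map_zero]
  rw [h1] at h4
  have hinj := (ModuleCat.mono_iff_injective i).1 hi.mono
  exact hs ((Submodule.Quotient.mk_eq_zero _).1 (hinj (h4.trans (map_zero _).symm)))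

end Cogenerator

/-! ### Consequences of the duality: kernels and injectives in `mod(C)`. -/

section Duality

variable {R : Type u} [CommRing R]
variable {C : Type u} [SmallCategory C] [Preadditive C] [Linear R C]

/-- The dual of a morphism of `C`-modules. -/
def dualMap (E : ModuleCat.{u} R) {M N : Mod R C} (f : M ⟶ N) : dual E N ⟶ dual E M :=
  (dualFunctor E).map f.op

/-- An element of a dual as a linear functional. -/
def functional {E : ModuleCat.{u} R} {M : Mod R C} {X : Cᵒᵖ} (φ : (dual E M).obj.obj X) :
    M.obj.obj (unop X) →ₗ[R] E := φ

/-- A linear functional as an element of the dual. -/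
def ofFunctional {E : ModuleCat.{u} R} {M : Mod R C} {X : Cᵒᵖ} (φ : M.obj.obj (unop X) →ₗ[R] E) :
    (dual E M).obj.obj X := φ

variable (C) in
/-- `E` is an injective cogenerator which induces a duality between `mod(C)` and `mod(Cᵒᵖ)`. -/
structure IsDualityModule (E : ModuleCat.{u} R) : Prop where
  injective : Injective E
  cogenerator : IsCogenerator E
  isFinPres_dual {M : Mod R C} : isFinPres R C M → isFinPres R Cᵒᵖ (dual E M)
  full {M N : Mod R C} : isFinPres R C M → isFinPres R C N → ∀ v : dual E N ⟶ dual E M,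
    ∃ f : M ⟶ N, dualMap E f = v
  faithful {M N : Mod R C} : isFinPres R C M → isFinPres R C N → ∀ f g : M ⟶ N,
    dualMap E f = dualMap E g → f = g
  essSurj {L : Mod R Cᵒᵖ} : isFinPres R Cᵒᵖ L →
    ∃ M : Mod R C, isFinPres R C M ∧ Nonempty (dual E M ≅ L)

theorem IsDualizing.exists_isDualityModule [IsArtinianRing R] [HasFiniteBiproducts C]
    [IsIdempotentComplete C] (hC : IsDualizing R C) :
    ∃ E : ModuleCat.{u} R, IsDualityModule C E := by
  obtain ⟨E, i, hi, hD, hF⟩ := hC.duality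
  refine ⟨E, hi.injective, isCogenerator_of_isInjectiveEnvelope hi, fun {M} hM => hD (op M) hM,
    fun {M N} hM hN v => ?_, fun {M N} hM hN f g hfg => ?_, fun {L} hL => ?_⟩
  · let X : (isFinPres R C).op.FullSubcategory := ⟨op N, hN⟩
    let Y : (isFinPres R C).op.FullSubcategory := ⟨op M, hM⟩
    obtain ⟨f, hf⟩ := hF.full.map_surjective (X := X) (Y := Y) (ObjectProperty.homMk v)
    exact ⟨f.hom.unop, congrArg (fun t => t.hom) hf⟩
  · let X : (isFinPres R C).op.FullSubcategory := ⟨op N, hN⟩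
    let Y : (isFinPres R C).op.FullSubcategory := ⟨op M, hM⟩
    have := hF.faithful.map_injective (X := X) (Y := Y) (a₁ := ObjectProperty.homMk f.op)
      (a₂ := ObjectProperty.homMk g.op) (InducedCategory.hom_ext hfg)
    exact Quiver.Hom.op_inj (congrArg (fun t => t.hom) this)
  · obtain ⟨M, ⟨e⟩⟩ := hF.essSurj.mem_essImage ⟨L, hL⟩
    exact ⟨M.obj.unop, M.property, ⟨(isFinPres R Cᵒᵖ).ι.mapIso e⟩⟩

namespace IsDualityModule

variable {E : ModuleCat.{u} R} (hE : IsDualityModule C E)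

include hE in
-- The dual of `K` is the cokernel of the dual of `f`, hence finitely presented, hence the dual of
-- some `M'` in `mod(C)`; by fullness the projection onto it comes from some `g : M' ⟶ M`. The same
-- functionals vanish on the images of `g` and `i`, so these coincide because `E` cogenerates, and
-- `K` is isomorphic to `M'`.
theorem isFinPres_ker [HasBinaryBiproducts C] {K M N : Mod R C} {i : K ⟶ M} {f : M ⟶ N}
    (hi : Mod.IsMono i) (hif : Mod.Exact i f) (hM : isFinPres R C M) (hN : isFinPres R C N) :
    isFinPres R C K := by
  obtain ⟨X, x, hx⟩ := exists_isGeneratedBy (hE.isFinPres_dual hN)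
  have hdi : Mod.IsEpi (dualMap E i) := fun X φ =>
    exists_extend hE.injective (Mod.app i (unop X)) (hi _) (functional φ)
  have hex : Mod.Exact (dualMap E f) (dualMap E i) := by
    intro X φ
    constructor
    · intro h
      -- A functional vanishing on `K` is defined on `M / ker f`, which embeds in `N`; injectivity
      -- of `E` extends it to `N`.
      have hφ : LinearMap.ker (Mod.app f (unop X)) ≤ LinearMap.ker (functional φ) := by
        intro y hy
        obtain ⟨z, rfl⟩ := (hif (unop X) y).1 hy
        exact LinearMap.congr_fun h z
      obtain ⟨ψ, hψ⟩ := exists_extend hE.injective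
        ((LinearMap.ker (Mod.app f (unop X))).liftQ (Mod.app f (unop X)) le_rfl)
        (LinearMap.ker_eq_bot.1 (Submodule.ker_liftQ_eq_bot _ _ _ le_rfl))
        (Submodule.liftQ _ (functional φ) hφ)
      exact ⟨ψ, LinearMap.ext fun y => LinearMap.congr_fun hψ (Submodule.Quotient.mk y)⟩
    · rintro ⟨ψ, rfl⟩
      refine LinearMap.ext fun z => ?_
      exact (congrArg (functional ψ) ((hif (unop X) _).2 ⟨z, rfl⟩)).trans (map_zero _)
  obtain ⟨M', hM', ⟨e⟩⟩ := hE.essSurj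
    (isFinPres_coker hx (hE.isFinPres_dual hM) _ _ hdi hex)
  obtain ⟨g, hg⟩ := hE.full hM' hM (dualMap E i ≫ e.inv)
  have hgapp (X : C) (φ : M.obj.obj X →ₗ[R] E) :
      Mod.app (dualMap E g) (op X) (ofFunctional φ) =
        Mod.app e.inv (op X) (Mod.app (dualMap E i) (op X) (ofFunctional φ)) := by
    rw [hg, Mod.app_comp]
  have hge : Mod.IsEpi (dualMap E g) := by
    rw [hg]
    exact fun X => (Mod.app_bijective e.inv X).2.comp (hdi X)
  have hgm : Mod.IsMono g := fun X => (injective_iff_map_eq_zero _).2 fun x hx => by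
    refine (Submodule.mem_bot R).1 (hE.cogenerator _ ⊥ x fun φ _ => ?_)
    obtain ⟨ψ, hψ⟩ := hge (op X) (ofFunctional φ)
    have : φ x = functional ψ (Mod.app g X x) := (LinearMap.congr_fun hψ x).symm
    rw [this, hx, map_zero]
  have hvan (X : C) (φ : M.obj.obj X →ₗ[R] E) :
      φ ∘ₗ Mod.app g X = 0 ↔ φ ∘ₗ Mod.app i X = 0 := by
    have h1 : Mod.app (dualMap E g) (op X) (ofFunctional φ) = 0 ↔
        Mod.app (dualMap E i) (op X) (ofFunctional φ) = 0 := by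
      rw [hgapp]
      exact map_eq_zero_iff _ (Mod.app_bijective e.inv (op X)).1
    exact h1
  have hrange (X : C) : LinearMap.range (Mod.app g X) = LinearMap.range (Mod.app i X) := by
    apply le_antisymm
    · rintro _ ⟨y, rfl⟩
      refine hE.cogenerator _ _ _ fun φ hφ => ?_
      exact LinearMap.congr_fun
        ((hvan X φ).2 (LinearMap.ext fun z => hφ _ ⟨z, rfl⟩)) y
    · rintro _ ⟨y, rfl⟩
      refine hE.cogenerator _ _ _ fun φ hφ => ?_
      exact LinearMap.congr_fun
        ((hvan X φ).1 (LinearMap.ext fun z => hφ _ ⟨z, rfl⟩)) y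
  obtain ⟨t, ht⟩ := Mod.exists_lift i hi g fun X x => hrange X ▸ ⟨x, rfl⟩
  have htapp X x : Mod.app i X (Mod.app t X x) = Mod.app g X x := by
    rw [← Mod.app_comp, ht]
  have : IsIso t := by
    refine Mod.isIso_of_bijective t fun X => ⟨fun x y hxy => hgm X ?_, fun z => ?_⟩
    · rw [← htapp, ← htapp, hxy]
    · obtain ⟨x, hx⟩ : Mod.app i X z ∈ LinearMap.range (Mod.app g X) := hrange X ▸ ⟨z, rfl⟩
      exact ⟨x, hi X (by rw [htapp, hx])⟩
  exact isFinPres_of_iso t hM'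

include hE in
theorem exists_ker [HasBinaryBiproducts C] {X Y : FPMod R C} (f : X ⟶ Y) :
    ∃ (K : FPMod R C) (i : K ⟶ X), Mod.IsMono i.hom ∧ Mod.Exact i.hom f.hom :=
  ⟨⟨(Mod.ker f.hom).toMod, hE.isFinPres_ker (Sub.incl_isMono _) (Mod.exact_incl_ker _)
    X.property Y.property⟩, ObjectProperty.homMk (Mod.ker f.hom).incl, Sub.incl_isMono _,
    Mod.exact_incl_ker _⟩

include hE in
theorem isFinPres_quotient_ker [HasBinaryBiproducts C] {X Y : FPMod R C} (f : X ⟶ Y) :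
    isFinPres R C (Mod.ker f.hom).quotient := by
  obtain ⟨c, x, hx⟩ := exists_isGeneratedBy
    (hE.isFinPres_ker (Sub.incl_isMono _) (Mod.exact_incl_ker f.hom) X.property Y.property)
  refine isFinPres_coker hx X.property (Mod.ker f.hom).incl _ (Sub.mkQ_isEpi _) fun c y => ?_
  exact (Sub.app_mkQ_eq_zero_iff _ y).trans ⟨fun h => ⟨⟨y, h⟩, rfl⟩, fun ⟨z, hz⟩ => hz ▸ z.2⟩

end IsDualityModule

/-- `I` represents the functor `X ↦ Hom_R(X(c), E)` through the functional `θ` on `I(c)`. -/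
structure IsNakayama (E : ModuleCat.{u} R) (c : C) (I : FPMod R C)
    (θ : I.obj.obj.obj c →ₗ[R] E) : Prop where
  exists_hom (X : FPMod R C) (φ : X.obj.obj.obj c →ₗ[R] E) :
    ∃ f : X ⟶ I, θ ∘ₗ Mod.app f.hom c = φ
  hom_ext {X : FPMod R C} (f g : X ⟶ I) :
    θ ∘ₗ Mod.app f.hom c = θ ∘ₗ Mod.app g.hom c → f = g

namespace IsDualityModule

variable {E : ModuleCat.{u} R} (hE : IsDualityModule C E)

include hE in
-- With `D` the duality, `Hom(X, I) = Hom(DI, DX) = Hom(Hom(-, c), DX) = DX(c)`, by full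
-- faithfulness and Yoneda; `θ` corresponds to the identity of `c`.
theorem exists_isNakayama_of_iso {c : C} {I : FPMod R C} (e : rep R (op c) ≅ dual E I.obj) :
    IsNakayama E c I (functional (Mod.app e.hom (op c) (𝟙 (op c)))) := by
  constructor
  · intro X φ
    obtain ⟨f, hf⟩ := hE.full X.property I.property
      (e.inv ≫ Mod.ofElt (M := dual E X.obj) (X := op c) (ofFunctional φ))
    refine ⟨ObjectProperty.homMk f, ?_⟩
    have h1 : e.hom ≫ dualMap E f = Mod.ofElt (ofFunctional φ) := by simp [hf]
    have h2 := congrArg (fun t => Mod.app t (op c) (𝟙 (op c))) h1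
    exact h2.trans ((dual E X.obj).act_id (X := op c) _)
  · intro X f g h
    apply InducedCategory.hom_ext
    apply hE.faithful X.property I.property
    rw [← cancel_epi e.hom]
    exact Mod.rep_hom_ext h

include hE in
theorem exists_isNakayama (c : C) :
    ∃ (I : FPMod R C) (θ : I.obj.obj.obj c →ₗ[R] E), IsNakayama E c I θ := by
  obtain ⟨M, hM, ⟨e⟩⟩ := hE.essSurj (isFinPres_rep (op c))
  exact ⟨⟨M, hM⟩, _, hE.exists_isNakayama_of_iso (I := ⟨M, hM⟩) e.symm⟩

include hE in
-- Dualizing an epimorphism from a representable onto the dual of `X`. This yields enough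
-- injectives.
theorem exists_isMono_isNakayama (X : FPMod R C) :
    ∃ (c : C) (I : FPMod R C) (θ : I.obj.obj.obj c →ₗ[R] E) (f : X ⟶ I),
      IsNakayama E c I θ ∧ Mod.IsMono f.hom := by
  obtain ⟨c, x, hx⟩ := exists_isGeneratedBy (hE.isFinPres_dual X.property)
  obtain ⟨M, hM, ⟨e⟩⟩ := hE.essSurj (isFinPres_rep c)
  obtain ⟨f, hf⟩ := hE.full X.property hM (e.hom ≫ Mod.ofElt x)
  refine ⟨unop c, ⟨M, hM⟩, _, ObjectProperty.homMk f,
    hE.exists_isNakayama_of_iso (I := ⟨M, hM⟩) e.symm, fun d => ?_⟩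
  refine (injective_iff_map_eq_zero _).2 fun y hy => ?_
  refine (Submodule.mem_bot R).1 (hE.cogenerator _ ⊥ y fun φ _ => ?_)
  have hge : Mod.IsEpi (dualMap E f) := by
    rw [hf]
    intro Z φ
    obtain ⟨a, ha⟩ := hx Z φ
    obtain ⟨b, hb⟩ := (Mod.app_bijective e.hom Z).2 a
    exact ⟨b, (congrArg (Mod.app (Mod.ofElt x) Z) hb).trans ha⟩
  obtain ⟨ψ, hψ⟩ := hge (op d) (ofFunctional φ)
  have hy : Mod.app f d y = 0 := hy
  have : φ y = functional ψ (Mod.app f d y) := (LinearMap.congr_fun hψ y).symm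
  rw [this, hy, map_zero]

end IsDualityModule

/-- The functor represented by `I` is evaluation at `c` followed by the exact functor `Hom_R(-, E)`.
-/
theorem IsNakayama.injective {E : ModuleCat.{u} R} (hE : Injective E) {c : C} {I : FPMod R C}
    {θ : I.obj.obj.obj c →ₗ[R] E} (hI : IsNakayama E c I θ) : Injective I where
  factors {X Y} g f _ := by
    obtain ⟨φ, hφ⟩ := exists_extend hE (Mod.app f.hom c) ((FPMod.mono_iff f).1 inferInstance c)
      (θ ∘ₗ Mod.app g.hom c)
    obtain ⟨h, hh⟩ := hI.exists_hom Y φ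
    refine ⟨h, hI.hom_ext _ _ ?_⟩
    rw [← hφ, ← hh]
    rfl

end Duality

/-! ### Direct summands of finite powers. -/

section Summands

variable {A : Type w} [Category.{v} A] [Preadditive A]

/-- `X` is a direct summand of a finite power of `M`, expressed by a decomposition of the
identity of `X`. -/
def IsSummand (M X : A) : Prop :=
  ∃ (n : ℕ) (a : Fin n → (X ⟶ M)) (b : Fin n → (M ⟶ X)), ∑ i, a i ≫ b i = 𝟙 X

theorem IsSummand.of_fintype {M X : A} {ι : Type*} [Fintype ι] (a : ι → (X ⟶ M))
    (b : ι → (M ⟶ X)) (h : ∑ i, a i ≫ b i = 𝟙 X) : IsSummand M X := by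
  let e := Fintype.equivFin ι
  refine ⟨Fintype.card ι, fun i => a (e.symm i), fun i => b (e.symm i), ?_⟩
  rw [← h]
  exact e.symm.sum_comp fun i => a i ≫ b i

theorem IsSummand.refl (M : A) : IsSummand M M :=
  ⟨1, fun _ => 𝟙 M, fun _ => 𝟙 M, by simp⟩

theorem IsSummand.trans {M N X : A} (hX : IsSummand N X) (hN : IsSummand M N) :
    IsSummand M X := by
  obtain ⟨n, a, b, h⟩ := hX
  obtain ⟨m, a', b', h'⟩ := hN
  refine .of_fintype (ι := Fin n × Fin m) (fun i => a i.1 ≫ a' i.2) (fun i => b' i.2 ≫ b i.1) ?_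
  rw [Fintype.sum_prod_type, ← h]
  refine Finset.sum_congr rfl fun i _ => ?_
  have : ∑ j, (a i ≫ a' j) ≫ b' j ≫ b i = a i ≫ (∑ j, a' j ≫ b' j) ≫ b i := by
    simp [Preadditive.comp_sum, Preadditive.sum_comp]
  rw [this, h', Category.id_comp]

theorem IsSummand.of_retract {M X : A} (i : X ⟶ M) (r : M ⟶ X) (h : i ≫ r = 𝟙 X) :
    IsSummand M X :=
  ⟨1, fun _ => i, fun _ => r, by simp [h]⟩

theorem isSummand_of_add {M X : A} (h : add M X) : IsSummand M X := by
  obtain ⟨Y, n, b, c, ⟨hb⟩, ⟨hc⟩, ⟨e⟩⟩ := h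
  refine ⟨n, fun i => b.inl ≫ e.hom ≫ c.π i, fun i => c.ι i ≫ e.inv ≫ b.fst, ?_⟩
  have : ∑ i, (b.inl ≫ e.hom ≫ c.π i) ≫ c.ι i ≫ e.inv ≫ b.fst =
      b.inl ≫ e.hom ≫ (∑ i, c.π i ≫ c.ι i) ≫ e.inv ≫ b.fst := by
    simp [Preadditive.comp_sum, Preadditive.sum_comp]
  rw [this, IsBilimit.total hc]
  simp

theorem isSummand_biproduct [HasFiniteBiproducts A] (M : A) (n : ℕ) :
    IsSummand M (⨁ fun _ : Fin n => M) :=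
  ⟨n, biproduct.π _, biproduct.ι (fun _ => M), biproduct.total⟩

/-- Summands of powers lie in `add(M)` as soon as split monomorphisms have cokernels. -/
theorem add_of_isSummand [HasFiniteBiproducts A]
    (hcoker : ∀ {X Y : A} (f : X ⟶ Y) [IsSplitMono f], HasCokernel f) {M X : A}
    (h : IsSummand M X) : add M X := by
  obtain ⟨n, a, b, h⟩ := h
  let f : X ⟶ ⨁ fun _ : Fin n => M := biproduct.lift a
  have : IsSplitMono f := ⟨⟨⟨biproduct.desc b, by simp [f, biproduct.lift_desc, h]⟩⟩⟩
  have := hcoker f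
  exact ⟨_, n, binaryBiconeOfIsSplitMonoOfCokernel (cokernelIsCokernel f),
    biproduct.bicone _, ⟨isBilimitBinaryBiconeOfIsSplitMonoOfCokernel (cokernelIsCokernel f)⟩,
    ⟨biproduct.isBilimit _⟩, ⟨Iso.refl _⟩⟩

theorem IsSummand.projective {M X : A} (hX : IsSummand M X) [Projective M] : Projective X where
  factors {Y Z} f e _ := by
    obtain ⟨n, a, b, h⟩ := hX
    refine ⟨∑ i, a i ≫ Projective.factorThru (b i ≫ f) e, ?_⟩
    rw [Preadditive.sum_comp]
    simp only [Category.assoc, Projective.factorThru_comp]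
    simp only [← Category.assoc]
    rw [← Preadditive.sum_comp, h, Category.id_comp]

theorem IsSummand.injective {M X : A} (hX : IsSummand M X) [Injective M] : Injective X where
  factors {Y Z} f e _ := by
    obtain ⟨n, a, b, h⟩ := hX
    refine ⟨∑ i, Injective.factorThru (f ≫ a i) e ≫ b i, ?_⟩
    rw [Preadditive.comp_sum]
    simp only [← Category.assoc, Injective.comp_factorThru]
    simp only [Category.assoc]
    rw [← Preadditive.comp_sum, h, Category.comp_id]

end Summands

/-! ### `Hom(P, -)` on summands of powers of `P` and of a representing object `I`. -/

section HomFunctor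

variable {A : Type w} [Category.{u} A] [Preadditive A] {P : A}

/-- An endomorphism of `P` as an element of the ring `End(P)ᵒᵖ`. -/
abbrev endOp (b : P ⟶ P) : (End P)ᵐᵒᵖ := MulOpposite.op b

theorem end_smul_def {X : A} (a : (End P)ᵐᵒᵖ) (v : P ⟶ X) : a • v = a.unop ≫ v := rfl

variable (P) in
/-- The action of `Hom(P, -)` on morphisms as linear maps. -/
def postcomp {X Y : A} (f : X ⟶ Y) : (P ⟶ X) →ₗ[(End P)ᵐᵒᵖ] (P ⟶ Y) :=
  ((preadditiveCoyonedaObj P).map f).hom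

@[simp]
theorem postcomp_apply {X Y : A} (f : X ⟶ Y) (v : P ⟶ X) : postcomp P f v = v ≫ f := rfl

theorem postcomp_comp {X Y Z : A} (f : X ⟶ Y) (g : Y ⟶ Z) :
    postcomp P (f ≫ g) = postcomp P g ∘ₗ postcomp P f :=
  LinearMap.ext fun v => (Category.assoc v f g).symm

theorem IsSummand.postcomp_injective {X : A} (hX : IsSummand P X) (Y : A) :
    Function.Injective (postcomp P : (X ⟶ Y) → _) := by
  obtain ⟨n, a, b, h⟩ := hX
  intro f g hfg
  rw [← Category.id_comp f, ← Category.id_comp g, ← h, Preadditive.sum_comp,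
    Preadditive.sum_comp]
  refine Finset.sum_congr rfl fun i _ => ?_
  rw [Category.assoc, Category.assoc]
  exact congrArg _ (LinearMap.congr_fun hfg (b i))

/-- The `b i` generate `Hom(P, X)` over `R_P`, so `t` is recovered from the values `t (b i)`. -/
theorem IsSummand.postcomp_surjective {X : A} (hX : IsSummand P X) (Y : A) :
    Function.Surjective (postcomp P : (X ⟶ Y) → _) := by
  obtain ⟨n, a, b, h⟩ := hX
  intro t
  refine ⟨∑ i, a i ≫ t (b i), LinearMap.ext fun v => ?_⟩
  have hv : t v = ∑ i, t ((v ≫ a i) ≫ b i) := by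
    simp only [Category.assoc]
    rw [← map_sum, ← Preadditive.comp_sum, h, Category.comp_id]
  rw [postcomp_apply, Preadditive.comp_sum, hv]
  refine Finset.sum_congr rfl fun i _ => ?_
  rw [← Category.assoc]
  exact (t.map_smul (endOp (v ≫ a i)) (b i)).symm

theorem IsSummand.finite {X : A} (hX : IsSummand P X) : Module.Finite (End P)ᵐᵒᵖ (P ⟶ X) := by
  obtain ⟨n, a, b, h⟩ := hX
  refine Module.Finite.of_surjective (Fintype.linearCombination (End P)ᵐᵒᵖ b) fun v =>
    ⟨fun i => endOp (v ≫ a i), ?_⟩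
  rw [Fintype.linearCombination_apply]
  simp only [end_smul_def, MulOpposite.unop_op, Category.assoc]
  rw [← Preadditive.comp_sum, h, Category.comp_id]

theorem IsSummand.module_projective {X : A} (hX : IsSummand P X) :
    Module.Projective (End P)ᵐᵒᵖ (P ⟶ X) := by
  obtain ⟨n, a, b, h⟩ := hX
  refine Module.Projective.of_split (M := Fin n → (End P)ᵐᵒᵖ)
    (LinearMap.pi fun i =>
      { toFun := fun v => endOp (v ≫ a i)
        map_add' := fun v w => congrArg endOp (Preadditive.add_comp _ _ _ v w (a i))
        map_smul' := fun r v => congrArg endOp (Category.assoc r.unop v (a i)) })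
    (Fintype.linearCombination (End P)ᵐᵒᵖ b) (LinearMap.ext fun v => ?_)
  rw [LinearMap.comp_apply, Fintype.linearCombination_apply]
  simp only [LinearMap.pi_apply, LinearMap.coe_mk, AddHom.coe_mk, end_smul_def,
    MulOpposite.unop_op, Category.assoc]
  rw [← Preadditive.comp_sum, h, Category.comp_id]
  rfl

theorem IsSummand.module_injective {I Y : A} (hY : IsSummand I Y)
    (hI : Module.Injective (End P)ᵐᵒᵖ (P ⟶ I)) : Module.Injective (End P)ᵐᵒᵖ (P ⟶ Y) where
  out V W _ _ _ _ f hf g := by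
    obtain ⟨n, a, b, h⟩ := hY
    choose t ht using fun i => hI.out f hf (postcomp P (a i) ∘ₗ g)
    refine ⟨∑ i, postcomp P (b i) ∘ₗ t i, fun v => ?_⟩
    rw [LinearMap.sum_apply]
    simp only [LinearMap.comp_apply, ht, postcomp_apply, Category.assoc]
    rw [← Preadditive.comp_sum, h, Category.comp_id]

section Represents

variable {R : Type u} [CommRing R] [Linear R A]

theorem algebraMap_smul_hom {X : A} (r : R) (v : P ⟶ X) :
    algebraMap R (End P)ᵐᵒᵖ r • v = r • v := by
  rw [MulOpposite.algebraMap_apply, end_smul_def, MulOpposite.unop_op,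
    Algebra.algebraMap_eq_smul_one]
  exact (Linear.smul_comp _ _ _ r (𝟙 P) v).trans (congrArg _ (Category.id_comp v))

instance isScalarTower_hom {X : A} : IsScalarTower R (End P)ᵐᵒᵖ (P ⟶ X) :=
  .of_algebraMap_smul algebraMap_smul_hom

/-- `I` represents the functor `X ↦ Hom_R(Hom(P, X), E)` through the functional `θ`. -/
structure Represents (P I : A) {E : Type u} [AddCommGroup E] [Module R E]
    (θ : (P ⟶ I) →ₗ[R] E) : Prop where
  exists_hom {X : A} (φ : (P ⟶ X) →ₗ[R] E) : ∃ f : X ⟶ I, ∀ v, θ (v ≫ f) = φ v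
  hom_ext {X : A} {f g : X ⟶ I} : (∀ v, θ (v ≫ f) = θ (v ≫ g)) → f = g

variable {I : A} {E : Type u} [AddCommGroup E] [Module R E] {θ : (P ⟶ I) →ₗ[R] E}

theorem Represents.postcomp_injective (hI : Represents P I θ) {Y : A} (hY : IsSummand I Y)
    (X : A) : Function.Injective (postcomp P : (X ⟶ Y) → _) := by
  obtain ⟨n, a, b, h⟩ := hY
  intro f g hfg
  rw [← Category.comp_id f, ← Category.comp_id g, ← h, Preadditive.comp_sum,
    Preadditive.comp_sum]
  refine Finset.sum_congr rfl fun i _ => ?_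
  rw [← Category.assoc, ← Category.assoc]
  refine congrArg (· ≫ b i) (hI.hom_ext fun v => ?_)
  rw [← Category.assoc, ← Category.assoc]
  exact congrArg (fun t => θ (t ≫ a i)) (LinearMap.congr_fun hfg v)

/-- Each component of `t` in `Hom(P, I)` gives, through `θ`, an `R`-linear functional on `Hom(P,
X)`, represented by some `f i`. Linearity of `t` over `R_P` shows that `f i` induces that component.
-/
theorem Represents.postcomp_surjective (hI : Represents P I θ) {Y : A} (hY : IsSummand I Y)
    (X : A) : Function.Surjective (postcomp P : (X ⟶ Y) → _) := by
  obtain ⟨n, a, b, h⟩ := hY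
  intro t
  choose f hf using fun i => hI.exists_hom
    (θ ∘ₗ Linear.rightComp R P (a i) ∘ₗ t.restrictScalars R)
  have key (i) (v : P ⟶ X) : v ≫ f i = t v ≫ a i := by
    refine hI.hom_ext fun w => ?_
    have h1 : t (w ≫ v) = w ≫ t v := t.map_smul (endOp w) v
    rw [← Category.assoc, hf, ← Category.assoc, ← h1]
    rfl
  refine ⟨∑ i, f i ≫ b i, LinearMap.ext fun v => ?_⟩
  rw [postcomp_apply, Preadditive.comp_sum, ← Category.comp_id (t v), ← h, Preadditive.comp_sum]
  refine Finset.sum_congr rfl fun i _ => ?_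
  rw [← Category.assoc, ← Category.assoc, key]

/-- Every functional on a module over `End(P)ᵒᵖ` comes from a homomorphism to `Hom(P, I)`. -/
theorem Represents.exists_linearMap (hI : Represents P I θ) {V : Type u} [AddCommGroup V]
    [Module (End P)ᵐᵒᵖ V] [Module R V] [IsScalarTower R (End P)ᵐᵒᵖ V] (φ : V →ₗ[R] E) :
    ∃ t : V →ₗ[(End P)ᵐᵒᵖ] (P ⟶ I), ∀ v, θ (t v) = φ v := by
  -- The image of `v` has to be the morphism `P ⟶ I` representing the functional `b ↦ φ(b • v)` on
  -- `Hom(P, P)`.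
  choose f hf using fun v : V => hI.exists_hom (X := P)
    { toFun := fun b => φ (endOp b • v)
      map_add' := fun b b' => by
        rw [← map_add, ← add_smul]
        rfl
      map_smul' := fun r b => by
        rw [RingHom.id_apply, ← map_smul, ← smul_assoc]
        rfl }
  have hf' (v : V) (b : P ⟶ P) : θ (b ≫ f v) = φ (endOp b • v) := hf v b
  refine ⟨{ toFun := f, map_add' := fun v w => ?_, map_smul' := fun a v => ?_ }, fun v => ?_⟩
  · refine hI.hom_ext fun b => ?_
    rw [Preadditive.comp_add, map_add, hf', hf', hf', smul_add, map_add]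
  · refine hI.hom_ext fun b => ?_
    rw [RingHom.id_apply, end_smul_def, ← Category.assoc, hf', hf', ← mul_smul]
    rfl
  · have h1 := hf' v (𝟙 P)
    rw [Category.id_comp] at h1
    refine h1.trans (congrArg φ ?_)
    exact one_smul (End P)ᵐᵒᵖ v

theorem Represents.linearMap_ext (hI : Represents P I θ) {V : Type u} [AddCommGroup V]
    [Module (End P)ᵐᵒᵖ V] {s t : V →ₗ[(End P)ᵐᵒᵖ] (P ⟶ I)} (h : ∀ v, θ (s v) = θ (t v)) :
    s = t := by
  refine LinearMap.ext fun v => hI.hom_ext fun b => ?_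
  have hb (q : V →ₗ[(End P)ᵐᵒᵖ] (P ⟶ I)) : b ≫ q v = q (endOp b • v) :=
    (q.map_smul (endOp b) v).symm
  rw [hb, hb, h]

/-- Maps from `V` to `Hom(P, I)` over `R_P` are the same as `R`-linear functionals `V → E`, so
injectivity of `E` over `R` transfers. -/
theorem Represents.module_injective {E : ModuleCat.{u} R} {θ : (P ⟶ I) →ₗ[R] E}
    (hE : Injective E) (hI : Represents P I θ) : Module.Injective (End P)ᵐᵒᵖ (P ⟶ I) where
  out V W _ _ _ _ f hf g := by
    let _ : Module R V := Module.compHom V (algebraMap R (End P)ᵐᵒᵖ)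
    let _ : Module R W := Module.compHom W (algebraMap R (End P)ᵐᵒᵖ)
    have : IsScalarTower R (End P)ᵐᵒᵖ V := .of_algebraMap_smul fun _ _ => rfl
    have : IsScalarTower R (End P)ᵐᵒᵖ W := .of_algebraMap_smul fun _ _ => rfl
    obtain ⟨ψ, hψ⟩ := exists_extend hE (f.restrictScalars R) hf (θ ∘ₗ g.restrictScalars R)
    obtain ⟨t, ht⟩ := hI.exists_linearMap ψ
    have : t ∘ₗ f = g := hI.linearMap_ext fun v =>
      (ht _).trans (LinearMap.congr_fun hψ v)
    exact ⟨t, fun v => LinearMap.congr_fun this v⟩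

end Represents

end HomFunctor

theorem restrictsToEquivalence_of {A : Type w} [Category.{v} A] {B : Type w'} [Category.{v'} B]
    {F : A ⥤ B} {S : ObjectProperty A} {T : ObjectProperty B} (hobj : ∀ X, S X → T (F.obj X))
    (hmap : ∀ X Y, S X → S Y → Function.Bijective (F.map : (X ⟶ Y) → _))
    (hsurj : ∀ V, T V → ∃ X, S X ∧ Nonempty (F.obj X ≅ V)) : RestrictsToEquivalence F S T := by
  refine ⟨hobj, ?_⟩
  refine { faithful := ⟨fun {X Y f g} h => ?_⟩, full := ⟨fun {X Y} f => ?_⟩,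
           essSurj := ⟨fun V => ?_⟩ }
  · exact InducedCategory.hom_ext
      ((hmap _ _ X.property Y.property).1 (congrArg (fun t => t.hom) h))
  · obtain ⟨g, hg⟩ := (hmap _ _ X.property Y.property).2 f.hom
    exact ⟨ObjectProperty.homMk g, InducedCategory.hom_ext hg⟩
  · obtain ⟨X, hX, ⟨e⟩⟩ := hsurj V.obj V.property
    exact ⟨⟨X, hX⟩, ⟨T.isoMk e⟩⟩

/-! ### Recursive sequences of morphisms. -/

section Resolutions

variable {A : Type w} [Category.{v} A]

/-- Iterating the choice of a morphism into the source of a morphism. -/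
def arrowSeq {f : Arrow A} (next : ∀ g : Arrow A, Over g.left) : ℕ → Arrow A
  | 0 => f
  | n + 1 => Arrow.mk (next (arrowSeq (f := f) next n)).hom

/-- Iterating the choice of a morphism out of the target of a morphism. -/
def arrowCoseq {f : Arrow A} (next : ∀ g : Arrow A, Under g.right) : ℕ → Arrow A
  | 0 => f
  | n + 1 => Arrow.mk (next (arrowCoseq (f := f) next n)).hom

end Resolutions

/-! ### Exactness of `Hom(P, -)`, diagram chases, existence of resolutions. -/

section FinPres

variable {R : Type u} [CommRing R]
variable {C : Type u} [SmallCategory C] [Preadditive C] [Linear R C]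

namespace FPMod

theorem hasCokernel [HasBinaryBiproducts C] {X Y : FPMod R C} (f : X ⟶ Y) : HasCokernel f := by
  obtain ⟨Z, q, hq, hfq⟩ := exists_coker f
  have : Epi q := epi_of_isEpi hq
  choose s hs using fun (K : CokernelCofork f) =>
    exists_desc_of_exact hq hfq (Cofork.π K) (CokernelCofork.condition K)
  exact ⟨⟨⟨CokernelCofork.ofπ q (comp_eq_zero_of_exact hfq),
    Cofork.IsColimit.mk _ s hs fun K m hm => (cancel_epi q).1 (hm.trans (hs K).symm)⟩⟩⟩

theorem add_iff_isSummand [HasFiniteBiproducts C] {M X : FPMod R C} :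
    add M X ↔ IsSummand M X := by
  have := hasBinaryBiproducts_of_finite_biproducts C
  exact ⟨isSummand_of_add, add_of_isSummand fun f _ => hasCokernel f⟩

variable {c : C}

theorem postcomp_surjective_of_isEpi {X Y : FPMod R C} {f : X ⟶ Y} (hf : Mod.IsEpi f.hom) :
    Function.Surjective (postcomp (fpRep R c) f) := fun v => by
  obtain ⟨x, hx⟩ := hf c (elt v)
  exact ⟨ofElt x, elt_injective (by rw [postcomp_apply, elt_comp, elt_ofElt, hx])⟩

theorem postcomp_exact {X Y Z : FPMod R C} {f : X ⟶ Y} {g : Y ⟶ Z}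
    (h : Mod.Exact f.hom g.hom) :
    Function.Exact (postcomp (fpRep R c) f) (postcomp (fpRep R c) g) := fun v => by
  have h1 : postcomp (fpRep R c) g v = 0 ↔ Mod.app g.hom c (elt v) = 0 :=
    (elt_injective (X := Z) (c := c)).eq_iff.symm
  rw [h1, h c]
  constructor
  · rintro ⟨x, hx⟩
    exact ⟨ofElt x, elt_injective (by rw [postcomp_apply, elt_comp, elt_ofElt, hx])⟩
  · rintro ⟨w, rfl⟩
    exact ⟨elt w, rfl⟩

theorem postcomp_injective_of_isMono {P X Y : FPMod R C} {f : X ⟶ Y} (hf : Mod.IsMono f.hom) :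
    Function.Injective (postcomp P f) := fun v w h => by
  have := (mono_iff f).2 hf
  exact (cancel_mono f).1 h

section Comparison

variable {P : FPMod R C}

theorem postcomp_injective_of_isEpi {Q X Y : FPMod R C} {p : Q ⟶ X} (hp : Mod.IsEpi p.hom)
    (hQ : Function.Injective (postcomp P : (Q ⟶ Y) → _)) :
    Function.Injective (postcomp P : (X ⟶ Y) → _) := by
  intro f g hfg
  have := epi_of_isEpi hp
  rw [← cancel_epi p]
  apply hQ
  rw [postcomp_comp, postcomp_comp, hfg]

theorem postcomp_injective_of_isMono_target {X Y I : FPMod R C} {i : Y ⟶ I}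
    (hi : Mod.IsMono i.hom) (hI : Function.Injective (postcomp P : (X ⟶ I) → _)) :
    Function.Injective (postcomp P : (X ⟶ Y) → _) := by
  intro f g hfg
  have := (mono_iff i).2 hi
  rw [← cancel_mono i]
  apply hI
  rw [postcomp_comp, postcomp_comp, hfg]

/-- Realise `t` on `Q₀`; the result kills `d` because its image under `Hom(P, -)` does and
faithfulness holds on `Q₁`, so it descends to the cokernel `X`. -/
theorem postcomp_surjective_of_presentation {Q₁ Q₀ X Y : FPMod R C} {d : Q₁ ⟶ Q₀} {p : Q₀ ⟶ X}
    (hp : Mod.IsEpi p.hom) (hdp : Mod.Exact d.hom p.hom)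
    (hPp : Function.Surjective (postcomp P p))
    (h₁ : Function.Injective (postcomp P : (Q₁ ⟶ Y) → _))
    (h₀ : Function.Surjective (postcomp P : (Q₀ ⟶ Y) → _)) :
    Function.Surjective (postcomp P : (X ⟶ Y) → _) := by
  intro t
  obtain ⟨g, hg⟩ := h₀ (t ∘ₗ postcomp P p)
  have hdg : d ≫ g = 0 := h₁ (by
    rw [postcomp_comp, hg, LinearMap.comp_assoc, ← postcomp_comp, comp_eq_zero_of_exact hdp]
    ext v
    simp)
  obtain ⟨f, rfl⟩ := exists_desc_of_exact hp hdp g hdg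
  refine ⟨f, LinearMap.ext fun v => ?_⟩
  obtain ⟨w, rfl⟩ := hPp v
  rw [postcomp_comp] at hg
  exact LinearMap.congr_fun hg w

theorem postcomp_surjective_of_copresentation {X Y I₀ I₁ : FPMod R C} {i : Y ⟶ I₀}
    {d : I₀ ⟶ I₁} (hi : Mod.IsMono i.hom) (hid : Mod.Exact i.hom d.hom)
    (h₁ : Function.Injective (postcomp P : (X ⟶ I₁) → _))
    (h₀ : Function.Surjective (postcomp P : (X ⟶ I₀) → _)) :
    Function.Surjective (postcomp P : (X ⟶ Y) → _) := by
  intro t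
  obtain ⟨g, hg⟩ := h₀ (postcomp P i ∘ₗ t)
  have hgd : g ≫ d = 0 := h₁ (by
    rw [postcomp_comp, hg, ← LinearMap.comp_assoc, ← postcomp_comp, comp_eq_zero_of_exact hid]
    ext v
    simp)
  obtain ⟨f, rfl⟩ := exists_lift_of_exact hi hid g hgd
  refine ⟨f, LinearMap.ext fun v => postcomp_injective_of_isMono hi ?_⟩
  rw [postcomp_comp] at hg
  exact LinearMap.congr_fun hg v

/-- Realising `t` once into `I` and once on `Q` gives a commutative square from `p` to `i`; its
diagonal fill-in induces `t`. -/
theorem postcomp_surjective_of_isEpi_of_isMono {Q X Y I : FPMod R C} {p : Q ⟶ X} {i : Y ⟶ I}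
    (hp : Mod.IsEpi p.hom) (hi : Mod.IsMono i.hom)
    (hQ : ∀ Z : FPMod R C, Function.Bijective (postcomp P : (Q ⟶ Z) → _))
    (hI : Function.Surjective (postcomp P : (X ⟶ I) → _)) :
    Function.Surjective (postcomp P : (X ⟶ Y) → _) := by
  intro t
  obtain ⟨g, hg⟩ := hI (postcomp P i ∘ₗ t)
  obtain ⟨h, hh⟩ := (hQ Y).2 (t ∘ₗ postcomp P p)
  have hgh : p ≫ g = h ≫ i := (hQ I).1 (by
    rw [postcomp_comp, postcomp_comp, hg, hh, LinearMap.comp_assoc])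
  have hgh' (d : C) (x : Q.obj.obj.obj d) :
      Mod.app g.hom d (Mod.app p.hom d x) = Mod.app i.hom d (Mod.app h.hom d x) := by
    simp only [← Mod.app_comp, ← ObjectProperty.FullSubcategory.comp_hom, hgh]
  obtain ⟨f, rfl⟩ := exists_lift i hi g fun d x => by
    obtain ⟨y, rfl⟩ := hp d x
    exact ⟨_, (hgh' d y).symm⟩
  refine ⟨f, LinearMap.ext fun v => postcomp_injective_of_isMono hi ?_⟩
  rw [postcomp_comp] at hg
  exact LinearMap.congr_fun hg v

end Comparison

end FPMod

section Existence

variable [HasFiniteBiproducts C]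

namespace IsDualityModule

variable {E : ModuleCat.{u} R} (hE : IsDualityModule C E)

include hE in
-- Only `Q₀` and `Q₁` are constrained; the resolution continues by covering successive kernels with
-- representables.
theorem PP_one_of_exact {P Q₁ Q₀ X : FPMod R C} [Projective P] {d : Q₁ ⟶ Q₀} {p : Q₀ ⟶ X}
    (h₁ : IsSummand P Q₁) (h₀ : IsSummand P Q₀) (hp : Mod.IsEpi p.hom)
    (hdp : Mod.Exact d.hom p.hom) : PP P 1 X := by
  have := hasBinaryBiproducts_of_finite_biproducts C
  have key (g : Arrow (FPMod R C)) : ∃ k : Over g.left, Projective k.left ∧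
      Mod.Exact k.hom.hom g.hom.hom := by
    obtain ⟨K, i, _, hK⟩ := hE.exists_ker g.hom
    obtain ⟨x, q, hq⟩ := FPMod.exists_isEpi_fpRep K
    refine ⟨Over.mk (q ≫ i), FPMod.projective_fpRep x, fun y v => (hK y v).trans ⟨?_, ?_⟩⟩
    · rintro ⟨w, rfl⟩
      obtain ⟨z, rfl⟩ := hq y w
      exact ⟨z, rfl⟩
    · rintro ⟨z, rfl⟩
      exact ⟨_, rfl⟩
  choose next hproj hex using key
  -- The target of `st (n + 1)` is by definition the source of `st n`, so the targets are the terms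
  -- of the resolution, beginning with `Q₀`, `Q₁`.
  let st := arrowSeq (f := Arrow.mk d) next
  have hst (n : ℕ) : Projective (st n).left ∧ Projective (st n).right := by
    induction n with
    | zero => exact ⟨h₁.projective, h₀.projective⟩
    | succ n ih => exact ⟨hproj _, ih.1⟩
  refine ⟨fun n => (st n).right, fun n => (st n).hom, p, fun n => (hst n).2, hp, hdp,
    fun n => hex (st n), fun n hn => ?_⟩
  have hn : n ≤ 1 := by exact_mod_cast hn
  interval_cases n
  · exact FPMod.add_iff_isSummand.2 h₀
  · exact FPMod.add_iff_isSummand.2 h₁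

include hE in
theorem II_one_of_exact {J Y I₀ I₁ : FPMod R C} [Injective J] {i : Y ⟶ I₀} {d : I₀ ⟶ I₁}
    (h₀ : IsSummand J I₀) (h₁ : IsSummand J I₁) (hi : Mod.IsMono i.hom)
    (hid : Mod.Exact i.hom d.hom) : II J 1 Y := by
  have := hasBinaryBiproducts_of_finite_biproducts C
  have key (g : Arrow (FPMod R C)) : ∃ k : Under g.right, Injective k.right ∧
      Mod.Exact g.hom.hom k.hom.hom := by
    obtain ⟨K, q, _, hK⟩ := FPMod.exists_coker g.hom
    obtain ⟨x, I, θ, j, hI, hj⟩ := hE.exists_isMono_isNakayama K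
    refine ⟨Under.mk (q ≫ j), hI.injective hE.injective, fun y v => Iff.trans ?_ (hK y v)⟩
    exact map_eq_zero_iff (Mod.app j.hom y) (hj y)
  choose next hinj hex using key
  let st := arrowCoseq (f := Arrow.mk d) next
  have hst (n : ℕ) : Injective (st n).left ∧ Injective (st n).right := by
    induction n with
    | zero => exact ⟨h₀.injective, h₁.injective⟩
    | succ n ih => exact ⟨ih.2, hinj _⟩
  refine ⟨fun n => (st n).left, fun n => (st n).hom, i, fun n => (hst n).1, hi, hid,
    fun n => hex (st n), fun n hn => ?_⟩
  have hn : n ≤ 1 := by exact_mod_cast hn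
  interval_cases n
  · exact FPMod.add_iff_isSummand.2 h₀
  · exact FPMod.add_iff_isSummand.2 h₁

end IsDualityModule

omit [HasFiniteBiproducts C] in
theorem IsNakayama.represents {E : ModuleCat.{u} R} {c : C} {I : FPMod R C}
    {θ : I.obj.obj.obj c →ₗ[R] E} (hI : IsNakayama E c I θ) :
    Represents (fpRep R c) I (θ ∘ₗ (FPMod.eltEquiv I c).toLinearMap) := by
  constructor
  · intro X φ
    obtain ⟨f, hf⟩ := hI.exists_hom X (φ ∘ₗ (FPMod.eltEquiv X c).symm.toLinearMap)
    refine ⟨f, fun v => (LinearMap.congr_fun hf (FPMod.elt v)).trans ?_⟩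
    exact congrArg φ (FPMod.ofElt_elt v)
  · intro X f g h
    refine hI.hom_ext f g (LinearMap.ext fun x => ?_)
    have := h (FPMod.ofElt x)
    change θ (Mod.app f.hom c (FPMod.elt (FPMod.ofElt x))) =
      θ (Mod.app g.hom c (FPMod.elt (FPMod.ofElt x))) at this
    rwa [FPMod.elt_ofElt] at this

omit [HasFiniteBiproducts C] in
theorem finite_hom (hfin : ∀ X Y : C, Module.Finite R (X ⟶ Y)) (c : C) (X : FPMod R C) :
    Module.Finite R (fpRep R c ⟶ X) := by
  obtain ⟨d, x, hx⟩ := exists_isGeneratedBy X.property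
  have := hfin d c
  have : Module.Finite R (X.obj.obj.obj c) :=
    Module.Finite.of_surjective (X.obj.orbit x c) fun y => hx c y
  exact Module.Finite.equiv (FPMod.eltEquiv X c).symm

end Existence

section AbstractExistence

variable {A : Type w} [Category.{u} A] [Preadditive A] [HasFiniteBiproducts A] {P : A}

/-- `Hom(P, Pⁿ)` is the free `R_P`-module of rank `n`. -/
theorem exists_surjective_biproduct (P : A) (V : Type u) [AddCommGroup V] [Module (End P)ᵐᵒᵖ V]
    [Module.Finite (End P)ᵐᵒᵖ V] :
    ∃ (n : ℕ) (t : (P ⟶ ⨁ fun _ : Fin n => P) →ₗ[(End P)ᵐᵒᵖ] V), Function.Surjective t := by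
  obtain ⟨n, f, hf⟩ := Module.Finite.exists_fin' (End P)ᵐᵒᵖ V
  let g (i : Fin n) : (P ⟶ P) →ₗ[(End P)ᵐᵒᵖ] V :=
    { toFun := fun b => endOp b • f (Pi.single i 1)
      map_add' := fun b b' => add_smul (endOp b) (endOp b') _
      map_smul' := fun a b => mul_smul a (endOp b) _ }
  refine ⟨n, ∑ i, g i ∘ₗ postcomp P (biproduct.π (fun _ => P) i), fun v => ?_⟩
  obtain ⟨x, rfl⟩ := hf v
  refine ⟨biproduct.lift fun i => (x i).unop, ?_⟩
  rw [LinearMap.sum_apply, LinearMap.pi_apply_eq_sum_univ f x]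
  refine Finset.sum_congr rfl fun i _ => ?_
  rw [LinearMap.comp_apply, postcomp_apply, biproduct.lift_π]
  change x i • f (Pi.single i 1) = _
  congr 2
  ext j
  simp [Pi.single_apply, eq_comm]

variable {R : Type u} [CommRing R] [IsArtinianRing R] [Linear R A]

/-- As `Hom(P, X)` is artinian over `R`, finitely many of the separating maps suffice; they are the
components of `f`. -/
theorem exists_postcomp_injective_of_separates {X J : A} [Module.Finite R (P ⟶ X)]
    (h : ∀ v : P ⟶ X, (∀ f : X ⟶ J, v ≫ f = 0) → v = 0) :
    ∃ (n : ℕ) (f : X ⟶ ⨁ fun _ : Fin n => J), Function.Injective (postcomp P f) := by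
  obtain ⟨n, k, hk⟩ := exists_fin_forall_eq_zero
    (fun f : X ⟶ J => LinearMap.ker (Linear.rightComp R P f)) ⊥ h
  refine ⟨n, biproduct.lift k, (injective_iff_map_eq_zero _).2 fun v hv => ?_⟩
  refine (Submodule.mem_bot R).1 (hk v fun i => ?_)
  have h1 : v ≫ biproduct.lift k = 0 := hv
  change v ≫ k i = 0
  rw [← biproduct.lift_π k i, ← Category.assoc, h1, zero_comp]

theorem Represents.exists_postcomp_injective {I : A} {E : ModuleCat.{u} R} {θ : (P ⟶ I) →ₗ[R] E}
    (hI : Represents P I θ) (hE : IsCogenerator E) (X : A) [Module.Finite R (P ⟶ X)] :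
    ∃ (n : ℕ) (f : X ⟶ ⨁ fun _ : Fin n => I), Function.Injective (postcomp P f) :=
  exists_postcomp_injective_of_separates (R := R) fun v hv =>
    (Submodule.mem_bot R).1 <| hE _ ⊥ v fun φ _ => by
      obtain ⟨f, hf⟩ := hI.exists_hom φ
      rw [← hf, hv f, map_zero]

end AbstractExistence

end FinPres

/-! ### Density of `Hom(P, -)` on `ℙ₁` and `𝕀₁`. -/

section EssentialSurjectivity

variable {R : Type u} [CommRing R]
variable {C : Type u} [SmallCategory C] [Preadditive C] [Linear R C] [HasFiniteBiproducts C]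

namespace IsDualityModule

variable {E : ModuleCat.{u} R} (hE : IsDualityModule C E)

include hE in
-- A finite free presentation of `V` lifts to `d` between powers of `P`; by exactness of `Hom(P, -)`
-- the cokernel of `d` is sent to `V`.
theorem exists_PP_one (c : C) [IsNoetherianRing (EndRing (fpRep R c))]
    (V : ModuleCat.{u} (EndRing (fpRep R c))) [Module.Finite (EndRing (fpRep R c)) V] :
    ∃ X : FPMod R C, PP (fpRep R c) 1 X ∧ Nonempty ((homFunctor (fpRep R c)).obj X ≅ V) := by
  have := hasBinaryBiproducts_of_finite_biproducts C
  obtain ⟨n, t, ht⟩ := exists_surjective_biproduct (fpRep R c) V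
  have := (isSummand_biproduct (fpRep R c) n).finite
  obtain ⟨m, s, hs⟩ := exists_surjective_biproduct (fpRep R c) (LinearMap.ker t)
  obtain ⟨d, hd⟩ := (isSummand_biproduct (fpRep R c) m).postcomp_surjective _
    ((LinearMap.ker t).subtype ∘ₗ s)
  obtain ⟨X, p, hp, hdp⟩ := FPMod.exists_coker d
  have hker : LinearMap.ker (postcomp (fpRep R c) p) = LinearMap.ker t := by
    rw [(FPMod.postcomp_exact hdp).linearMap_ker_eq, hd, LinearMap.range_comp,
      LinearMap.range_eq_top.2 hs, Submodule.map_top, Submodule.range_subtype]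
  refine ⟨X, hE.PP_one_of_exact (isSummand_biproduct _ m) (isSummand_biproduct _ n) hp hdp,
    ⟨LinearEquiv.toModuleIso ?_⟩⟩
  exact ((postcomp (fpRep R c) p).quotKerEquivOfSurjective
    (FPMod.postcomp_surjective_of_isEpi hp)).symm ≪≫ₗ
      Submodule.quotEquivOfEq _ _ hker ≪≫ₗ t.quotKerEquivOfSurjective ht

include hE in
-- Take `f : X ⟶ Iⁿ` and `g : coker f ⟶ Iᵐ`, both injective after `Hom(P, -)` though perhaps not
-- monomorphisms. The kernel `Y` of `Iⁿ ⟶ Iᵐ` may differ from `X`, but in `Hom(P, Iⁿ)` both have the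
-- same image.
theorem exists_II_one [IsArtinianRing R] (hfin : ∀ X Y : C, Module.Finite R (X ⟶ Y)) {c : C}
    {I : FPMod R C} [Injective I] {θ : (fpRep R c ⟶ I) →ₗ[R] E}
    (hI : Represents (fpRep R c) I θ) (X : FPMod R C) :
    ∃ Y : FPMod R C, II I 1 Y ∧
      Nonempty ((homFunctor (fpRep R c)).obj Y ≅ (homFunctor (fpRep R c)).obj X) := by
  have := hasBinaryBiproducts_of_finite_biproducts C
  have := finite_hom hfin c X
  obtain ⟨n, f, hf⟩ := hI.exists_postcomp_injective hE.cogenerator X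
  obtain ⟨Z, q, _, hfq⟩ := FPMod.exists_coker f
  have := finite_hom hfin c Z
  obtain ⟨m, g, hg⟩ := hI.exists_postcomp_injective hE.cogenerator Z
  obtain ⟨Y, i, hi, hid⟩ := hE.exists_ker (q ≫ g)
  have hrange : LinearMap.range (postcomp (fpRep R c) i) =
      LinearMap.range (postcomp (fpRep R c) f) := by
    rw [← (FPMod.postcomp_exact hid).linearMap_ker_eq,
      ← (FPMod.postcomp_exact hfq).linearMap_ker_eq, postcomp_comp]
    exact LinearMap.ker_comp_of_ker_eq_bot _ (LinearMap.ker_eq_bot.2 hg)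
  refine ⟨Y, hE.II_one_of_exact (isSummand_biproduct _ n) (isSummand_biproduct _ m) hi hid,
    ⟨LinearEquiv.toModuleIso ?_⟩⟩
  exact LinearEquiv.ofInjective _ (FPMod.postcomp_injective_of_isMono hi) ≪≫ₗ
    LinearEquiv.ofEq _ _ hrange ≪≫ₗ (LinearEquiv.ofInjective _ hf).symm

end IsDualityModule

end EssentialSurjectivity

/-! ### The radical of a representable functor. -/

section Radical

variable {R : Type u} [CommRing R]
variable {C : Type u} [SmallCategory C] [Preadditive C] [Linear R C] {c : C}

variable (R) in
/-- The largest submodule of `Hom(c, -)` whose value at `c` is contained in a left ideal. -/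
def subOfIdeal (m : Ideal (End c)) : Sub (rep R c) where
  carrier X :=
    { carrier := {f : c ⟶ X | ∀ g : X ⟶ c, (f ≫ g : End c) ∈ m}
      add_mem' := fun {f f'} hf hf' g => by
        have : (f + f' : c ⟶ X) ≫ g = f ≫ g + f' ≫ g := Preadditive.add_comp _ _ _ _ _ _
        exact this ▸ m.add_mem (hf g) (hf' g)
      zero_mem' := fun g => by
        have : (0 : c ⟶ X) ≫ g = 0 := zero_comp
        exact this ▸ m.zero_mem
      smul_mem' := fun r f hf g => by
        have : (r • f : c ⟶ X) ≫ g = f ≫ (r • g) :=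
          (Linear.smul_comp _ _ _ r f g).trans (Linear.comp_smul _ _ _ f r g).symm
        exact this ▸ hf (r • g) }
  map_mem {X Y} f x hx g := by
    have : ((rep R c).act f x : c ⟶ Y) ≫ g = (x : c ⟶ X) ≫ f ≫ g := Category.assoc _ _ _
    exact this ▸ hx (f ≫ g)

/-- The value at `c` of a submodule of `Hom(c, -)`, as a left ideal. -/
def idealOfSub (N : Sub (rep R c)) : Ideal (End c) where
  carrier := {f : c ⟶ c | f ∈ N.carrier c}
  add_mem' := (N.carrier c).add_mem
  zero_mem' := (N.carrier c).zero_mem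
  -- In `End c` the product `a * x` is `x ≫ a`, so stability under `C` gives a left ideal.
  smul_mem' a _ hx := N.map_mem a hx

theorem mem_idealOfSub {N : Sub (rep R c)} {f : c ⟶ c} :
    f ∈ idealOfSub N ↔ f ∈ N.carrier c := Iff.rfl

theorem Sub.le_def {M : Mod R C} {N N' : Sub M} :
    N ≤ N' ↔ ∀ X, N.carrier X ≤ N'.carrier X := Iff.rfl

theorem eq_top_of_id_mem {N : Sub (rep R c)} (h : (𝟙 c : c ⟶ c) ∈ N.carrier c) : N = ⊤ := by
  refine top_le_iff.1 (Sub.le_def.2 fun X (f : c ⟶ X) _ => ?_)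
  have : 𝟙 c ≫ f ∈ N.carrier X := N.map_mem f h
  rwa [Category.id_comp] at this

theorem le_subOfIdeal {N : Sub (rep R c)} {m : Ideal (End c)} (h : idealOfSub N ≤ m) :
    N ≤ subOfIdeal R m := fun _ _ hf g => h (N.map_mem g hf)

theorem id_notMem_subOfIdeal {m : Ideal (End c)} (hm : m ≠ ⊤) :
    (𝟙 c : c ⟶ c) ∉ (subOfIdeal R m).carrier c := fun h => by
  have h1 : (𝟙 c ≫ 𝟙 c : End c) ∈ m := h (𝟙 c)
  rw [Category.id_comp] at h1
  exact hm ((Ideal.eq_top_iff_one m).2 h1)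

theorem subOfIdeal_ne_top {m : Ideal (End c)} (hm : m ≠ ⊤) : subOfIdeal R m ≠ ⊤ := fun h =>
  id_notMem_subOfIdeal (R := R) hm (h.ge c trivial)

/-- A proper submodule does not contain `𝟙 c`, so its value at `c` is a proper left ideal; if it
contains `m` it equals `m`, and `subOfIdeal R m` is the largest such submodule. -/
theorem isCoatom_subOfIdeal {m : Ideal (End c)} (hm : m.IsMaximal) :
    IsCoatom (subOfIdeal R m) := by
  refine ⟨subOfIdeal_ne_top hm.ne_top, fun N hN => ?_⟩
  by_contra hne
  have hN1 : idealOfSub N ≠ ⊤ := fun h =>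
    hne (eq_top_of_id_mem (mem_idealOfSub.1 (h ▸ Submodule.mem_top)))
  have hmN : m ≤ idealOfSub N := fun f hf => hN.le c fun g => m.mul_mem_left g hf
  exact hN.not_ge (le_subOfIdeal (hm.eq_of_le hN1 hmN).ge)

theorem exists_eq_subOfIdeal {N : Sub (rep R c)} (hN : IsCoatom N) :
    ∃ m : Ideal (End c), m.IsMaximal ∧ N = subOfIdeal R m := by
  obtain ⟨m, hm, hNm⟩ := (idealOfSub N).exists_le_maximal fun h =>
    hN.1 (eq_top_of_id_mem (mem_idealOfSub.1 (h ▸ Submodule.mem_top)))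
  refine ⟨m, hm, ?_⟩
  exact ((hN.le_iff.1 (le_subOfIdeal hNm)).resolve_left (subOfIdeal_ne_top hm.ne_top)).symm

/-- The maximal submodules are exactly those attached to maximal left ideals of `End c`. -/
theorem mem_rad_rep {X : C} {f : c ⟶ X} : f ∈ (rad (rep R c)).carrier X ↔
    ∀ g : X ⟶ c, (f ≫ g : End c) ∈ Ring.jacobson (End c) := by
  have h1 : f ∈ (rad (rep R c)).carrier X ↔
      ∀ N : {N : Sub (rep R c) // IsCoatom N}, f ∈ N.1.carrier X :=
    Submodule.mem_iInf (x := (show (rep R c).obj.obj X from f)) _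
  have h2 (a : End c) : a ∈ Ring.jacobson (End c) ↔ ∀ m : Ideal (End c), m.IsMaximal → a ∈ m := by
    rw [Ring.jacobson_eq_sInf_isMaximal]
    exact Submodule.mem_sInf
  rw [h1]
  constructor
  · intro h g
    exact (h2 _).2 fun m hm => h ⟨_, isCoatom_subOfIdeal hm⟩ g
  · rintro h ⟨N, hN⟩
    obtain ⟨m, hm, rfl⟩ := exists_eq_subOfIdeal hN
    exact fun g => (h2 _).1 (h g) m hm

theorem mem_rad_rep_of_mem_jacobson {f : c ⟶ c} (h : (f : End c) ∈ Ring.jacobson (End c)) :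
    f ∈ (rad (rep R c)).carrier c :=
  mem_rad_rep.2 fun g => Ideal.mul_mem_left (Ring.jacobson (End c)) (g : End c) h

theorem mem_rad_rep_iff_mem_jacobson {f : c ⟶ c} :
    f ∈ (rad (rep R c)).carrier c ↔ (f : End c) ∈ Ring.jacobson (End c) := by
  refine ⟨fun h => ?_, mem_rad_rep_of_mem_jacobson⟩
  have := mem_rad_rep.1 h (𝟙 c)
  rwa [Category.comp_id] at this

end Radical

/-! ### The embedding of `P / rad P` into a power of `I`. -/

section Top

variable {R : Type u} [CommRing R] [IsArtinianRing R]
variable {C : Type u} [SmallCategory C] [Preadditive C] [Linear R C] [HasFiniteBiproducts C]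

omit [IsArtinianRing R] [HasFiniteBiproducts C] in
theorem FPMod.ofElt_comp_eq_zero_iff {X Y : FPMod R C} {d : C} (u : X ⟶ Y)
    (x : X.obj.obj.obj d) : FPMod.ofElt x ≫ u = 0 ↔ Mod.app u.hom d x = 0 := by
  rw [← FPMod.elt_injective.eq_iff, FPMod.elt_comp, FPMod.elt_ofElt]
  exact Iff.rfl

omit [IsArtinianRing R] in
theorem FPMod.app_lift_eq_zero_iff {X Y : FPMod R C} {n : ℕ} (k : Fin n → (X ⟶ Y)) {d : C}
    (x : X.obj.obj.obj d) :
    Mod.app (biproduct.lift k).hom d x = 0 ↔ ∀ i, Mod.app (k i).hom d x = 0 := by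
  simp only [← FPMod.ofElt_comp_eq_zero_iff]
  constructor
  · intro h i
    rw [← biproduct.lift_π k i, ← Category.assoc, h, zero_comp]
  · intro h
    apply biproduct.hom_ext
    intro i
    rw [Category.assoc, biproduct.lift_π, h, zero_comp]

omit [IsArtinianRing R] [HasFiniteBiproducts C] in
theorem IsNakayama.eq_zero {E : ModuleCat.{u} R} {c d : C} {I : FPMod R C}
    {θ : I.obj.obj.obj c →ₗ[R] E} (hI : IsNakayama E c I θ) {x : I.obj.obj.obj d}
    (h : ∀ g : d ⟶ c, θ (I.obj.act g x) = 0) : x = 0 := by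
  have : FPMod.ofElt x = 0 := hI.hom_ext _ _ (LinearMap.ext fun g => (h g).trans (map_zero θ).symm)
  exact (FPMod.elt_ofElt x).symm.trans (congrArg FPMod.elt this)

/-- Functionals on `End c` vanishing on the radical correspond to maps `P ⟶ I` killing `rad P`; they
cut out the radical at `c`, and finitely many suffice. Other objects reduce to `c`, since membership
in `rad P` and vanishing in `I` are both tested along morphisms to `c`. -/
theorem IsNakayama.exists_ker_eq_rad {E : ModuleCat.{u} R} (hE : IsCogenerator E) {c : C}
    [Module.Finite R (c ⟶ c)] {I : FPMod R C} {θ : I.obj.obj.obj c →ₗ[R] E}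
    (hI : IsNakayama E c I θ) :
    ∃ (n : ℕ) (f : fpRep R c ⟶ ⨁ fun _ : Fin n => I), Mod.ker f.hom = rad (rep R c) := by
  have : Module.Finite R ((fpRep R c).obj.obj.obj c) := ‹Module.Finite R (c ⟶ c)›
  obtain ⟨n, k, hk⟩ := exists_fin_forall_eq_zero (M := (fpRep R c).obj.obj.obj c)
    (fun k : {k : fpRep R c ⟶ I // ∀ f ∈ (rad (rep R c)).carrier c, Mod.app k.hom c f = 0} =>
      LinearMap.ker (Mod.app k.1.hom c)) ((rad (rep R c)).carrier c) fun v hv => by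
    refine hE _ _ v fun φ hφ => ?_
    obtain ⟨k, hk⟩ := hI.exists_hom (fpRep R c) φ
    have hkφ (x : c ⟶ c) : θ (Mod.app k.hom c x) = φ x := LinearMap.congr_fun hk x
    have h0 : Mod.app k.hom c v = 0 := hv ⟨k, fun f hf => hI.eq_zero fun g =>
      (congrArg θ (Mod.app_act k.hom g f).symm).trans
        ((hkφ _).trans (hφ _ ((rad (rep R c)).map_mem g hf)))⟩
    exact (hkφ v).symm.trans ((congrArg θ h0).trans (map_zero θ))
  refine ⟨n, biproduct.lift fun i => (k i).1, ?_⟩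
  have hlift {X : C} (a : c ⟶ X) : a ∈ (Mod.ker (biproduct.lift fun i => (k i).1).hom).carrier X ↔
      ∀ i, Mod.app (k i).1.hom X a = 0 := FPMod.app_lift_eq_zero_iff (X := fpRep R c) _ a
  refine Sub.ext (funext fun X => Submodule.ext fun (a : c ⟶ X) => (hlift a).trans ⟨?_, ?_⟩)
  · intro h
    refine mem_rad_rep.2 fun g => mem_rad_rep_iff_mem_jacobson.1 (hk _ fun i => ?_)
    exact (Mod.app_act (k i).1.hom g a).trans ((congrArg _ (h i)).trans (map_zero _))
  · intro ha i
    refine hI.eq_zero fun g => (congrArg θ (Mod.app_act (k i).1.hom g a).symm).trans ?_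
    exact (congrArg θ ((k i).2 _ ((rad (rep R c)).map_mem g ha))).trans (map_zero θ)

end Top

/-! ### Existence of the injective envelope, and its comparison with `I`. -/

section Envelope

variable {R : Type u} [CommRing R]
variable {C : Type u} [SmallCategory C] [Preadditive C] [Linear R C] [HasFiniteBiproducts C]

namespace IsDualityModule

variable {E : ModuleCat.{u} R} (hE : IsDualityModule C E)

include hE in
theorem exists_split {X : FPMod R C} (e : X ⟶ X) (he : e ≫ e = e) :
    ∃ (Y : FPMod R C) (i : Y ⟶ X) (r : X ⟶ Y), i ≫ r = 𝟙 Y ∧ r ≫ i = e := by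
  have := hasBinaryBiproducts_of_finite_biproducts C
  obtain ⟨Y, i, hi, hex⟩ := hE.exists_ker (𝟙 X - e)
  obtain ⟨r, hr⟩ := FPMod.exists_lift_of_exact hi hex e
    (by rw [Preadditive.comp_sub, Category.comp_id, he, sub_self])
  have hie : i ≫ e = i := by
    have := FPMod.comp_eq_zero_of_exact hex
    rw [Preadditive.comp_sub, Category.comp_id, sub_eq_zero] at this
    exact this.symm
  have := (FPMod.mono_iff i).2 hi
  refine ⟨Y, i, r, ?_, hr⟩
  rw [← cancel_mono i, Category.assoc, hr, hie, Category.id_comp]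

end IsDualityModule

omit [HasFiniteBiproducts C] in
-- A morphism `f` into `J` killed by `g` has `Hom(P, f) = 0`, and `Hom(P, -)` is faithful on
-- morphisms into summands of powers of `I`.
theorem Represents.mono_of_postcomp_injective {P I J Z : FPMod R C} {E : Type u} [AddCommGroup E]
    [Module R E] {θ : (P ⟶ I) →ₗ[R] E} (hI : Represents P I θ) (hJ : IsSummand I J) {g : J ⟶ Z}
    (hg : Function.Injective (postcomp P g)) : Mono g := by
  refine (FPMod.mono_iff_comp_eq_zero g).2 fun d f hf => ?_
  refine hI.postcomp_injective hJ _ (LinearMap.ext fun v => hg ?_)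
  rw [← LinearMap.comp_apply, ← postcomp_comp, hf]
  simp

/-- A module of finite type over an artinian ring has an idempotent endomorphism fixing the
vectors fixed by `t`, and whose image is contained in that of `t`. -/
theorem exists_idempotent_range_le {A : Type*} [Ring A] {V : Type*} [AddCommGroup V] [Module A V]
    [IsArtinian A V] [IsNoetherian A V] (t : Module.End A V) :
    ∃ p : Module.End A V, p * p = p ∧ LinearMap.range p ≤ LinearMap.range t ∧
      ∀ v, t v = v → p v = v := by
  obtain ⟨n, hn⟩ := Filter.eventually_atTop.1 (LinearMap.eventually_isCompl_ker_pow_range_pow t)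
  -- Fitting decomposition. The exponent `n + 1` is positive, which puts the range of the power
  -- inside that of `t`.
  have hc := (hn (n + 1) n.le_succ).symm
  refine ⟨Submodule.projection _ _ hc, Submodule.isIdempotentElem_projection hc, ?_,
    fun v hv => ?_⟩
  · rw [Submodule.range_projection, pow_succ']
    exact LinearMap.range_comp_le_range _ _
  · refine Submodule.projection_apply_left hc ⟨v, v, ?_⟩
    rw [Module.End.pow_apply]
    exact Function.iterate_fixed hv _

/-- Among the endomorphisms of `J₀` fixing `j`, choose one whose range on `Hom(P, J₀)` is minimal.
Fitting's lemma replaces it by an idempotent `e₀`, and `J` is the summand of `J₀` cut out by `e₀`.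
-/
theorem IsDualityModule.exists_isInjectiveEnvelope {E : ModuleCat.{u} R}
    (hE : IsDualityModule C E) {P I S J₀ : FPMod R C} [IsArtinian (EndRing P) (P ⟶ J₀)]
    [IsNoetherian (EndRing P) (P ⟶ J₀)] [Injective I] {θ : (P ⟶ I) →ₗ[R] E}
    (hI : Represents P I θ) (hJ₀ : IsSummand I J₀) (j : S ⟶ J₀) [Mono j] :
    ∃ (J : FPMod R C) (i : S ⟶ J), IsInjectiveEnvelope i := by
  have := hJ₀.injective
  obtain ⟨_, ⟨e, he, rfl⟩, hmin⟩ := (wellFounded_lt (α := Submodule (EndRing P) (P ⟶ J₀))).has_min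
    {N | ∃ e : J₀ ⟶ J₀, j ≫ e = j ∧ LinearMap.range (postcomp P e) = N} ⟨_, 𝟙 _, by simp, rfl⟩
  obtain ⟨p, hpp, hpe, hp⟩ := exists_idempotent_range_le (postcomp P e)
  obtain ⟨e₀, rfl⟩ := hI.postcomp_surjective hJ₀ J₀ p
  have he₀ : e₀ ≫ e₀ = e₀ := hI.postcomp_injective hJ₀ _ (by rw [postcomp_comp]; exact hpp)
  have hje₀ : j ≫ e₀ = j := hI.postcomp_injective hJ₀ _ (LinearMap.ext fun v => by
    rw [postcomp_apply, ← Category.assoc]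
    exact hp _ (by rw [postcomp_apply, Category.assoc, he]))
  obtain ⟨J, i, r, hir, hri⟩ := hE.exists_split e₀ he₀
  have hJ : IsSummand I J := (IsSummand.of_retract i r hir).trans hJ₀
  have hjr : (j ≫ r) ≫ i = j := by rw [Category.assoc, hri, hje₀]
  refine ⟨J, j ≫ r, mono_of_mono_fac hjr, hJ.injective, fun Z g hg => ?_⟩
  let h := Injective.factorThru j ((j ≫ r) ≫ g)
  have hh : ((j ≫ r) ≫ g) ≫ h = j := Injective.comp_factorThru _ _
  -- This also fixes `j`, so by minimality its range is that of `e₀`. Hence `g ≫ h ≫ r` is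
  -- surjective on the noetherian module `Hom(P, J)`, therefore injective, and `g` is a
  -- monomorphism.
  let e₁ := r ≫ g ≫ h ≫ e₀
  have hje₁ : j ≫ e₁ = j := by
    simp only [e₁, ← Category.assoc]
    rw [hh, hje₀]
  have hle : LinearMap.range (postcomp P e₁) ≤ LinearMap.range (postcomp P e₀) := by
    rintro _ ⟨v, rfl⟩
    exact ⟨v ≫ r ≫ g ≫ h, by simp [e₁]⟩
  have heq : LinearMap.range (postcomp P e₀) ≤ LinearMap.range (postcomp P e₁) := by
    by_contra hlt
    exact hmin _ ⟨e₁, hje₁, rfl⟩ ((lt_of_le_not_ge hle hlt).trans_le hpe)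
  have : IsNoetherian (EndRing P) (P ⟶ J) :=
    isNoetherian_of_injective (postcomp P i) fun v w hvw => by
      have := congrArg (· ≫ r) hvw
      simpa [hir] using this
  have hsurj : Function.Surjective (postcomp P (g ≫ h ≫ r)) := fun v => by
    obtain ⟨w, hw⟩ := heq ⟨v ≫ i, show (v ≫ i) ≫ e₀ = v ≫ i by
      rw [← hri, Category.assoc, ← Category.assoc i, hir, Category.id_comp]⟩
    refine ⟨w ≫ r, ?_⟩
    have := congrArg (· ≫ r) hw
    simpa [e₁, ← hri, hir] using this
  have hinj := IsNoetherian.injective_of_surjective_endomorphism _ hsurj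
  rw [postcomp_comp] at hinj
  exact hI.mono_of_postcomp_injective hJ (Function.Injective.of_comp (f := postcomp P (h ≫ r)) hinj)

theorem IsInjectiveEnvelope.isSummand {A : Type w} [Category.{v} A] [Preadditive A] {S J K : A}
    {i : S ⟶ J} (hi : IsInjectiveEnvelope i) [Injective K] (j : S ⟶ K) [Mono j] :
    IsSummand K J := by
  have := hi.mono
  have := hi.injective
  let g := Injective.factorThru j i
  have hg : i ≫ g = j := Injective.comp_factorThru _ _
  have : Mono g := hi.essential g (by rw [hg]; infer_instance)
  exact .of_retract g (Injective.factorThru (𝟙 J) g) (Injective.comp_factorThru _ _)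

/-- If a map from a submodule generated by one element is well defined, it extends to an
injective module. -/
theorem exists_linearMap_apply_eq {A : Type u} [Ring A] {V W : Type u} [AddCommGroup V]
    [Module A V] [AddCommGroup W] [Module A W] (hW : Module.Injective A W) (v : V) (w : W)
    (h : ∀ a : A, a • v = 0 → a • w = 0) : ∃ t : V →ₗ[A] W, t v = w := by
  let f := LinearMap.toSpanSingleton A V v
  let g := LinearMap.toSpanSingleton A W w
  obtain ⟨t, ht⟩ := hW.out ((LinearMap.ker f).liftQ f le_rfl)
    (LinearMap.ker_eq_bot.1 (Submodule.ker_liftQ_eq_bot _ _ _ le_rfl))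
    ((LinearMap.ker f).liftQ g h)
  refine ⟨t, ?_⟩
  have h1 : t ((1 : A) • v) = (1 : A) • w := ht (Submodule.Quotient.mk 1)
  rwa [one_smul, one_smul] at h1

/-- For nonzero `ξ` in `Hom(P, I)`, the cyclic module generated by `ξ` maps nontrivially to `Hom(P,
J)`, through the top of `P`. Injectivity of `Hom(P, J)` extends this map to `Hom(P, I)`, where it is
induced by some `I ⟶ J`. So maps to `J` separate `Hom(P, I)`; finitely many form a monomorphism `I ⟶
Jⁿ`, which splits. -/
theorem Represents.isSummand_of_envelope [IsArtinianRing R] {c : C} [Module.Finite R (c ⟶ c)]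
    {I J : FPMod R C} [Injective I] [Module.Finite R (fpRep R c ⟶ I)]
    {E : Type u} [AddCommGroup E] [Module R E] {θ : (fpRep R c ⟶ I) →ₗ[R] E}
    (hI : Represents (fpRep R c) I θ)
    (hIinj : Module.Injective (EndRing (fpRep R c)) (fpRep R c ⟶ I))
    (hS : isFinPres R C (rad (fpRep R c).obj).quotient)
    (i : (⟨(rad (fpRep R c).obj).quotient, hS⟩ : FPMod R C) ⟶ J) [Mono i] (hJ : IsSummand I J) :
    IsSummand J I := by
  have : Module.Finite R (End c) := ‹Module.Finite R (c ⟶ c)›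
  have : IsArtinianRing (End c) := IsArtinianRing.of_finite R (End c)
  have hsep (ξ : fpRep R c ⟶ I) (hξ : ∀ ψ : I ⟶ J, ξ ≫ ψ = 0) : ξ = 0 := by
    by_contra hne
    -- The annihilator of `ξ`, transported to `End c` by Yoneda.
    let K : Ideal (End c) :=
      { carrier := {b : c ⟶ c | I.obj.act b (FPMod.elt ξ) = 0}
        add_mem' := fun {a b} ha hb => by
          refine (I.obj.act_add a b _).trans ?_
          rw [show I.obj.act a _ = 0 from ha, show I.obj.act b _ = 0 from hb, add_zero]
        zero_mem' := I.obj.act_zero _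
        smul_mem' := fun a b hb => by
          refine (I.obj.act_comp b a _).trans ?_
          rw [show I.obj.act b _ = 0 from hb, map_zero] }
    have hK : K ≠ ⊤ := fun h => by
      have h1 : I.obj.act (𝟙 c) (FPMod.elt ξ) = 0 := (Ideal.eq_top_iff_one K).1 h
      rw [Mod.act_id] at h1
      exact hne (FPMod.elt_injective h1)
    obtain ⟨s, hs, hKs⟩ := exists_notMem_jacobson_mul_mem K hK
    let q : fpRep R c ⟶ (⟨(rad (fpRep R c).obj).quotient, hS⟩ : FPMod R C) :=
      ObjectProperty.homMk (rad (fpRep R c).obj).mkQ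
    have hq (b : c ⟶ c) : FPMod.ofElt (X := fpRep R c) b ≫ q = 0 ↔
        (b : End c) ∈ Ring.jacobson (End c) :=
      (FPMod.ofElt_comp_eq_zero_iff q _).trans
        ((Sub.app_mkQ_eq_zero_iff (rad (rep R c)) _).trans mem_rad_rep_iff_mem_jacobson)
    let t : fpRep R c ⟶ J := FPMod.ofElt (X := fpRep R c) (s : c ⟶ c) ≫ q ≫ i
    have ht : t ≠ 0 := fun h => hs <| (hq s).1 <| by
      rw [← cancel_mono i, Category.assoc, zero_comp]
      exact h
    obtain ⟨u, hu⟩ := exists_linearMap_apply_eq (hJ.module_injective hIinj) ξ t fun a ha => by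
      have ha' : a.unop ≫ ξ = 0 := ha
      have haK : (FPMod.elt a.unop : End c) ∈ K := by
        have h1 : FPMod.elt (FPMod.ofElt (FPMod.elt a.unop) ≫ ξ) = 0 := by
          rw [FPMod.ofElt_elt, ha']
          rfl
        exact (FPMod.elt_ofElt_comp (FPMod.elt a.unop) ξ).symm.trans h1
      have h2 : a.unop ≫ FPMod.ofElt (X := fpRep R c) (s : c ⟶ c) =
          FPMod.ofElt (X := fpRep R c) ((s : c ⟶ c) ≫ (FPMod.elt a.unop : c ⟶ c)) := by
        refine FPMod.elt_injective (Eq.trans ?_ (FPMod.elt_ofElt (X := fpRep R c) _).symm)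
        rfl
      have h3 : FPMod.ofElt (X := fpRep R c) ((s : c ⟶ c) ≫ (FPMod.elt a.unop : c ⟶ c)) ≫ q = 0 :=
        (hq _).2 (hKs _ haK)
      have h4 : a.unop ≫ t = 0 := by
        simp only [t, ← Category.assoc]
        rw [h2, h3, zero_comp]
      exact h4
    obtain ⟨ψ, rfl⟩ := hI.postcomp_surjective hJ I u
    exact ht (hu.symm.trans (hξ ψ))
  obtain ⟨n, f, hf⟩ := exists_postcomp_injective_of_separates (R := R) hsep
  have : Mono f := hI.mono_of_postcomp_injective (.refl I) hf
  exact (IsSummand.of_retract f (Injective.factorThru (𝟙 I) f)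
    (Injective.comp_factorThru _ _)).trans (isSummand_biproduct J n)

end Envelope

/-! ### Comparison maps on `ℙ_k` and `𝕀_k`; projective and injective modules. -/

section Equivalences

variable {R : Type u} [CommRing R]
variable {C : Type u} [SmallCategory C] [Preadditive C] [Linear R C]

theorem rho_injective {P X Y : FPMod R C} (h : Function.Injective (postcomp P : (X ⟶ Y) → _)) :
    Function.Injective (rho P X Y) := fun _ _ hfg =>
  h (congrArg ModuleCat.Hom.hom hfg)

theorem rho_surjective {P X Y : FPMod R C} (h : Function.Surjective (postcomp P : (X ⟶ Y) → _)) :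
    Function.Surjective (rho P X Y) := fun t => by
  obtain ⟨f, hf⟩ := h t.hom
  exact ⟨f, ModuleCat.hom_ext hf⟩

variable {P J X : FPMod R C}

theorem PP.exists_isEpi (h : PP P 0 X) :
    ∃ (Q : FPMod R C) (p : Q ⟶ X), IsSummand P Q ∧ Mod.IsEpi p.hom := by
  obtain ⟨Q, d, p, -, hp, -, -, hQ⟩ := h
  exact ⟨Q 0, p, isSummand_of_add (hQ 0 le_rfl), hp⟩

theorem PP.exists_presentation (h : PP P 1 X) :
    ∃ (Q₁ Q₀ : FPMod R C) (d : Q₁ ⟶ Q₀) (p : Q₀ ⟶ X), IsSummand P Q₁ ∧ IsSummand P Q₀ ∧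
      Mod.IsEpi p.hom ∧ Mod.Exact d.hom p.hom := by
  obtain ⟨Q, d, p, -, hp, hd, -, hQ⟩ := h
  exact ⟨Q 1, Q 0, d 0, p, isSummand_of_add (hQ 1 (by simp)),
    isSummand_of_add (hQ 0 (by simp)), hp, hd⟩

theorem II.exists_isMono (h : II J 0 X) :
    ∃ (I : FPMod R C) (i : X ⟶ I), IsSummand J I ∧ Mod.IsMono i.hom := by
  obtain ⟨I, d, i, -, hi, -, -, hI⟩ := h
  exact ⟨I 0, i, isSummand_of_add (hI 0 le_rfl), hi⟩

theorem II.exists_copresentation (h : II J 1 X) :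
    ∃ (I₀ I₁ : FPMod R C) (i : X ⟶ I₀) (d : I₀ ⟶ I₁), IsSummand J I₀ ∧ IsSummand J I₁ ∧
      Mod.IsMono i.hom ∧ Mod.Exact i.hom d.hom := by
  obtain ⟨I, d, i, -, hi, hd, -, hI⟩ := h
  exact ⟨I 0, I 1, i, d 0, isSummand_of_add (hI 0 (by simp)),
    isSummand_of_add (hI 1 (by simp)), hi, hd⟩

/-- The restriction of `Hom(P, -)` to an equivalence, in terms of its action on morphisms. -/
theorem restrictsToEquivalence_homFunctor {S : ObjectProperty (FPMod R C)}
    {T : ObjectProperty (ModuleCat.{u} (EndRing P))}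
    (hobj : ∀ X, S X → T ((homFunctor P).obj X))
    (hmap : ∀ X Y, S X → S Y → Function.Bijective (postcomp P : (X ⟶ Y) → _))
    (hsurj : ∀ V, T V → ∃ X, S X ∧ Nonempty ((homFunctor P).obj X ≅ V)) :
    RestrictsToEquivalence (homFunctor P) S T :=
  restrictsToEquivalence_of hobj
    (fun X Y hX hY => ⟨rho_injective (hmap X Y hX hY).1, rho_surjective (hmap X Y hX hY).2⟩) hsurj

theorem PP.postcomp_injective (hX : PP P 0 X) (Y : FPMod R C) :
    Function.Injective (postcomp P : (X ⟶ Y) → _) := by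
  obtain ⟨Q, p, hQ, hp⟩ := hX.exists_isEpi
  exact FPMod.postcomp_injective_of_isEpi hp (hQ.postcomp_injective Y)

theorem PP.postcomp_bijective {c : C} {X : FPMod R C} (hX : PP (fpRep R c) 1 X) (Y : FPMod R C) :
    Function.Bijective (postcomp (fpRep R c) : (X ⟶ Y) → _) := by
  obtain ⟨Q₁, Q₀, d, p, h₁, h₀, hp, hdp⟩ := hX.exists_presentation
  exact ⟨FPMod.postcomp_injective_of_isEpi hp (h₀.postcomp_injective Y),
    FPMod.postcomp_surjective_of_presentation hp hdp (FPMod.postcomp_surjective_of_isEpi hp)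
      (h₁.postcomp_injective Y) (h₀.postcomp_surjective Y)⟩

variable {I : FPMod R C} {E : Type u} [AddCommGroup E] [Module R E] {θ : (P ⟶ I) →ₗ[R] E}

theorem Represents.postcomp_injective_of_II (hI : Represents P I θ) (hIJ : IsSummand I J)
    {Y : FPMod R C} (hY : II J 0 Y) (X : FPMod R C) :
    Function.Injective (postcomp P : (X ⟶ Y) → _) := by
  obtain ⟨K, i, hK, hi⟩ := hY.exists_isMono
  exact FPMod.postcomp_injective_of_isMono_target hi (hI.postcomp_injective (hK.trans hIJ) X)

theorem Represents.postcomp_bijective_of_II (hI : Represents P I θ) (hIJ : IsSummand I J)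
    {Y : FPMod R C} (hY : II J 1 Y) (X : FPMod R C) :
    Function.Bijective (postcomp P : (X ⟶ Y) → _) := by
  obtain ⟨K₀, K₁, i, d, h₀, h₁, hi, hid⟩ := hY.exists_copresentation
  exact ⟨FPMod.postcomp_injective_of_isMono_target hi (hI.postcomp_injective (h₀.trans hIJ) X),
    FPMod.postcomp_surjective_of_copresentation hi hid
      (hI.postcomp_injective (h₁.trans hIJ) X) (hI.postcomp_surjective (h₀.trans hIJ) X)⟩

theorem Represents.postcomp_bijective_of_PP_of_II (hI : Represents P I θ) (hIJ : IsSummand I J)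
    {X Y : FPMod R C} (hX : PP P 0 X) (hY : II J 0 Y) :
    Function.Bijective (postcomp P : (X ⟶ Y) → _) := by
  refine ⟨hX.postcomp_injective Y, ?_⟩
  obtain ⟨Q, p, hQ, hp⟩ := hX.exists_isEpi
  obtain ⟨K, i, hK, hi⟩ := hY.exists_isMono
  exact FPMod.postcomp_surjective_of_isEpi_of_isMono hp hi
    (fun Z => ⟨hQ.postcomp_injective Z, hQ.postcomp_surjective Z⟩)
    (hI.postcomp_surjective (hK.trans hIJ) X)

variable [HasFiniteBiproducts C]

theorem II.of_isSummand {I : FPMod R C} (hIJ : IsSummand J I) {k : ℕ∞} (h : II I k X) :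
    II J k X := by
  obtain ⟨K, d, i, hK, hi, hd, hd', hI⟩ := h
  exact ⟨K, d, i, hK, hi, hd, hd', fun n hn =>
    FPMod.add_iff_isSummand.2 ((isSummand_of_add (hI n hn)).trans hIJ)⟩

/-- Injectivity splits `Hom(P, Y)` off `Hom(P, K₀)`; since `Y` lies in `𝕀₁`, the retraction comes
from a morphism and `Y` is a summand of `K₀`. -/
theorem Represents.add_of_injective {Y : FPMod R C}
    (hI : Represents P I θ) (hIJ : IsSummand I J) (hY : II J 1 Y)
    (hinj : Module.Injective (EndRing P) (P ⟶ Y)) : add J Y := by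
  obtain ⟨K₀, K₁, i, d, h₀, h₁, hi, hid⟩ := hY.exists_copresentation
  obtain ⟨s, hs⟩ := hinj.out (postcomp P i) (FPMod.postcomp_injective_of_isMono hi) LinearMap.id
  obtain ⟨σ, rfl⟩ := (hI.postcomp_bijective_of_II hIJ hY K₀).2 s
  refine FPMod.add_iff_isSummand.2 ((IsSummand.of_retract i σ
    ((hI.postcomp_bijective_of_II hIJ hY Y).1 (LinearMap.ext fun v => ?_))).trans h₀)
  rw [postcomp_comp, LinearMap.comp_apply, hs]
  exact (Category.comp_id v).symm

namespace IsDualityModule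

variable {E : ModuleCat.{u} R} (hE : IsDualityModule C E)

include hE in
theorem exists_add_of_projective {c : C} [IsNoetherianRing (EndRing (fpRep R c))]
    {V : ModuleCat.{u} (EndRing (fpRep R c))} (hV : fgProj _ V) :
    ∃ X : FPMod R C, add (fpRep R c) X ∧ Nonempty ((homFunctor (fpRep R c)).obj X ≅ V) := by
  have := hV.1
  obtain ⟨X, hX, ⟨e⟩⟩ := hE.exists_PP_one c V
  refine ⟨X, FPMod.add_iff_isSummand.2 ?_, ⟨e⟩⟩
  have hXP : Module.Projective (EndRing (fpRep R c)) (fpRep R c ⟶ X) :=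
    have := hV.2
    Module.Projective.of_equiv e.toLinearEquiv.symm
  obtain ⟨Q₁, Q₀, d, p, h₁, h₀, hp, hdp⟩ := hX.exists_presentation
  obtain ⟨s, hs⟩ := Module.projective_lifting_property (postcomp (fpRep R c) p) LinearMap.id
    (FPMod.postcomp_surjective_of_isEpi hp)
  obtain ⟨σ, rfl⟩ := (hX.postcomp_bijective Q₀).2 s
  refine (IsSummand.of_retract σ p ((hX.postcomp_bijective X).1 ?_)).trans h₀
  rw [postcomp_comp, hs]
  exact LinearMap.ext fun v => (Category.comp_id v).symm

end IsDualityModule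

end Equivalences

end DualizingVarieties

end

open DualizingVarieties in
theorem mainTheorem9 {R : Type u} [CommRing R] [IsArtinianRing R]
    {C : Type u} [SmallCategory C] [Preadditive C] [Linear R C]
    [HasFiniteBiproducts C] [IsIdempotentComplete C]
    (hC : IsDualizing R C) (c : C) (P : FPMod R C) (hP : P = fpRep R c) :
    -- the functor `Hom(P, -)` takes values in `mod(R_P)`
    (∀ X : FPMod R C, fgMod (EndRing P) ((homFunctor P).obj X)) ∧
    -- `P / rad P` lies in `mod(C)` and has an injective envelope there
    ∃ hS : isFinPres R C (rad P.obj).quotient,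
      (∃ (J : FPMod R C) (i : (⟨(rad P.obj).quotient, hS⟩ : FPMod R C) ⟶ J),
        IsInjectiveEnvelope i) ∧
      ∀ (J : FPMod R C) (i : (⟨(rad P.obj).quotient, hS⟩ : FPMod R C) ⟶ J),
        IsInjectiveEnvelope i →
        -- the equivalences with `mod(R_P)`
        (RestrictsToEquivalence (homFunctor P) (PP P 1) (fgMod (EndRing P)) ∧
          RestrictsToEquivalence (homFunctor P) (II J 1) (fgMod (EndRing P))) ∧
        -- the comparison maps `ρ_{X,Y}`
        ((∀ X Y : FPMod R C, PP P 0 X ∨ II J 0 Y → Function.Injective (rho P X Y)) ∧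
          (∀ X Y : FPMod R C, PP P 0 X ∧ II J 0 Y → Function.Bijective (rho P X Y)) ∧
          (∀ X Y : FPMod R C, PP P 1 X ∨ II J 1 Y → Function.Bijective (rho P X Y))) ∧
        -- the equivalences with projective and with injective modules
        (RestrictsToEquivalence (homFunctor P) (add P) (fgProj (EndRing P)) ∧
          RestrictsToEquivalence (homFunctor P) (add J) (fgInj (EndRing P))) := by
  subst hP
  obtain ⟨E, hE⟩ := hC.exists_isDualityModule
  have := hasBinaryBiproducts_of_finite_biproducts C
  have hfin (X : FPMod R C) : Module.Finite R (fpRep R c ⟶ X) := finite_hom hC.homFinite c X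
  have hfinA : Module.Finite R (EndRing (fpRep R c)) :=
    have : Module.Finite R (End (fpRep R c)) := hfin (fpRep R c)
    Module.Finite.equiv (MulOpposite.opLinearEquiv R (M := End (fpRep R c)))
  have hnoeth : IsNoetherianRing (EndRing (fpRep R c)) :=
    IsNoetherianRing.of_finite R _
  have hart : IsArtinianRing (EndRing (fpRep R c)) := IsArtinianRing.of_finite R _
  have hfg (X : FPMod R C) : Module.Finite (EndRing (fpRep R c)) (fpRep R c ⟶ X) :=
    Module.Finite.of_restrictScalars_finite R _ _
  have hcc := hC.homFinite c c
  obtain ⟨I, θ, hIN⟩ := hE.exists_isNakayama c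
  have hI := hIN.represents
  have hIinj : Injective I := hIN.injective hE.injective
  have hFI := hI.module_injective hE.injective
  obtain ⟨n, f, hf⟩ := hIN.exists_ker_eq_rad hE.cogenerator
  have hS : isFinPres R C (rad (fpRep R c).obj).quotient := hf ▸ hE.isFinPres_quotient_ker f
  let S : FPMod R C := ⟨(rad (fpRep R c).obj).quotient, hS⟩
  let q : fpRep R c ⟶ S := ObjectProperty.homMk (rad (fpRep R c).obj).mkQ
  have hq : Mod.IsEpi q.hom := Sub.mkQ_isEpi _
  have hqf (d : C) (x : (fpRep R c).obj.obj.obj d) :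
      Mod.app q.hom d x = 0 ↔ Mod.app f.hom d x = 0 := by
    refine (Sub.app_mkQ_eq_zero_iff _ x).trans ?_
    have : (rad (fpRep R c).obj) = Mod.ker f.hom := hf.symm
    rw [this]
    exact Iff.rfl
  obtain ⟨j, hj⟩ := FPMod.exists_desc q hq f fun d x => (hqf d x).1
  have hjm : Mono j := (FPMod.mono_iff j).2 fun d => (injective_iff_map_eq_zero _).2 fun y hy => by
    obtain ⟨x, rfl⟩ := hq d y
    exact (hqf d x).2 ((congrArg (fun t => Mod.app t.hom d x) hj).symm.trans hy)
  have hIn := isSummand_biproduct I n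
  have := hIn.injective
  refine ⟨fun X => hfg X, hS, hE.exists_isInjectiveEnvelope hI hIn j, fun J i hi => ?_⟩
  -- This and `hJI` below give `add(I) = add(J)`: the first makes the results on `I` available for
  -- `add(J)`, the second turns coresolutions by `add(I)` into coresolutions by `add(J)`.
  have hIJ : IsSummand I J := (hi.isSummand j).trans hIn
  have := hi.mono
  have hJI : IsSummand J I := hI.isSummand_of_envelope hFI hS i hIJ
  have hII (V : ModuleCat.{u} (EndRing (fpRep R c)))
      (hV : Module.Finite (EndRing (fpRep R c)) V) :
      ∃ Y : FPMod R C, II J 1 Y ∧ Nonempty ((homFunctor (fpRep R c)).obj Y ≅ V) := by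
    obtain ⟨X, -, ⟨e⟩⟩ := hE.exists_PP_one c V
    obtain ⟨Y, hY, ⟨e'⟩⟩ := hE.exists_II_one hC.homFinite hI X
    exact ⟨Y, hY.of_isSummand hJI, ⟨e' ≪≫ e⟩⟩
  refine ⟨⟨?_, ?_⟩, ⟨?_, ?_, ?_⟩, ?_, ?_⟩
  · exact restrictsToEquivalence_homFunctor (fun X _ => hfg X)
      (fun X Y hX _ => hX.postcomp_bijective Y) fun V hV =>
        have : Module.Finite (EndRing (fpRep R c)) V := hV
        hE.exists_PP_one c V
  · exact restrictsToEquivalence_homFunctor (fun X _ => hfg X)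
      (fun X Y _ hY => hI.postcomp_bijective_of_II hIJ hY X) hII
  · rintro X Y (hX | hY)
    · exact rho_injective (hX.postcomp_injective Y)
    · exact rho_injective (hI.postcomp_injective_of_II hIJ hY X)
  · rintro X Y ⟨hX, hY⟩
    have := hI.postcomp_bijective_of_PP_of_II hIJ hX hY
    exact ⟨rho_injective this.1, rho_surjective this.2⟩
  · rintro X Y (hX | hY)
    · have := hX.postcomp_bijective Y
      exact ⟨rho_injective this.1, rho_surjective this.2⟩
    · have := hI.postcomp_bijective_of_II hIJ hY X
      exact ⟨rho_injective this.1, rho_surjective this.2⟩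
  · exact restrictsToEquivalence_homFunctor
      (fun X hX => ⟨hfg X, (isSummand_of_add hX).module_projective⟩)
      (fun X Y hX _ => ⟨(isSummand_of_add hX).postcomp_injective Y,
        (isSummand_of_add hX).postcomp_surjective Y⟩)
      fun V hV => hE.exists_add_of_projective hV
  · refine restrictsToEquivalence_homFunctor
      (fun X hX => ⟨hfg X, ((isSummand_of_add hX).trans hIJ).module_injective hFI⟩)
      (fun X Y _ hY => ⟨hI.postcomp_injective ((isSummand_of_add hY).trans hIJ) X,
        hI.postcomp_surjective ((isSummand_of_add hY).trans hIJ) X⟩) fun V hV => ?_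
    obtain ⟨Y, hY, ⟨e⟩⟩ := hII V hV.1
    exact ⟨Y, hI.add_of_injective hIJ hY (Module.Baer.injective
      ((Module.Baer.of_injective hV.2).of_equiv e.toLinearEquiv.symm)), ⟨e⟩⟩
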